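/- Let $G$ be a group, let $A$ be a group with a homomorphism $A\to\mathrm{Aut}(G)$ whose image is normalized by $\mathrm{Inn}(G)$. Define normal $A$-invariant subgroups $Z_\alpha(G,A)$ of $G$ for all ordinals $\alpha$ by $Z_0(G,A)=1$, $Z_{\alpha+1}(G,A)/Z_\alpha(G,A)=C_{G/Z_\alpha(G,A)}(A)$ (the subgroup of elements of the quotient fixed by $A$), and $Z_\lambda(G,A)=\bigcup_{\alpha<\lambda}Z_\alpha(G,A)$ for limit ordinals $\lambda$. The last term $Z_\infty(G,A)$ of this ascending series is the $A$-hypercenter of $G$, and $G$ is $A$-hypercentral if $G=Z_\alpha(G,A)$ for some ordinal $\alpha$. The hypercenter of a group $H$ is $Z_\infty(H,H)$ for the action of $H$ on itself by conjugation. If $L$ is a normal $A$-invariant subgroup of $G$, then $A$ acts on $G/L$ by the induced action, whose image is again normalized by $\mathrm{Inn}(G/L)$. **Theorem 2.** There are functions $f,h:\mathbb N\times\mathbb N\to\mathbb N$ such that the following holds. Let $G$ be a group and let $A\le\mathrm{Aut}(G)$ be a subgroup that is normalized by $\mathrm{Inn}(G)$ and such that the hypercenter of $A/(A\cap\mathrm{Inn}(G))$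 has finite index $k$. (B) If the $A$-hypercenter of $G$ has finite index $t$ in $G$, then there is a finite normal $A$-invariant subgroup $L$ of $G$ of order $|L|\le f(t,k)$ such that $G/L$ is $A$-hypercentral. (H) If there is a finite normal $A$-invariant subgroup $L$ of $G$ of order $d$ such that $G/L$ is $A$-hypercentral, then the $A$-hypercenter of $G$ has finite index at most $h(d,k)$ in $G$. -/

import Mathlib

universe u v w

noncomputable section

namespace ActionHypercenter

/-- The group `Inn(G)` of inner automorphisms, as a subgroup of `Aut(G)`. -/
def inn (G : Type u) [Group G] : Subgroup (MulAut G) :=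
  (MulAut.conj : G →* MulAut G).range

instance inn_normal (G : Type u) [Group G] : (inn G).Normal where
  conj_mem := by
    rintro _ ⟨g, rfl⟩ a
    exact ⟨a g, by ext x; simp⟩

section Action

variable {G : Type u} [Group G] {B : Type v} [Group B]

/-- The image of the action `φ : B → Aut(G)` is normalized by `Inn(G)`. -/
def NormalizedByInn (φ : B →* MulAut G) : Prop :=
  inn G ≤ Subgroup.normalizer (φ.range : Set (MulAut G))

/-- `N` is a `B`-subgroup: it is mapped into itself by every element of `B`
(hence onto itself, as `B` is a group). -/
def IsInvariant (φ : B →* MulAut G) (N : Subgroup G) : Prop :=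
  ∀ b : B, ∀ x ∈ N, φ b x ∈ N

theorem IsInvariant.map_eq {φ : B →* MulAut G} {N : Subgroup G} (h : IsInvariant φ N) (b : B) :
    N.map ((φ b : G ≃* G) : G →* G) = N := by
  ext x
  constructor
  · rintro ⟨y, hy, rfl⟩
    exact h b y hy
  · intro hx
    exact ⟨φ b⁻¹ x, h b⁻¹ x hx, by simp⟩

/-- The action induced on the quotient by a normal `B`-subgroup: `b • gN = (b • g)N`. -/
def quotientAction (φ : B →* MulAut G) (N : Subgroup G) [N.Normal] (h : IsInvariant φ N) :
    B →* MulAut (G ⧸ N) where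
  toFun b := QuotientGroup.congr N N (φ b) (h.map_eq b)
  map_one' := by
    ext x
    induction x using QuotientGroup.induction_on with
    | H g => simp
  map_mul' a b := by
    ext x
    induction x using QuotientGroup.induction_on with
    | H g => simp

@[simp]
theorem quotientAction_mk (φ : B →* MulAut G) (N : Subgroup G) [N.Normal] (h : IsInvariant φ N)
    (b : B) (g : G) : quotientAction φ N h b (g : G ⧸ N) = (φ b g : G) := rfl

theorem NormalizedByInn.exists_conj {φ : B →* MulAut G} (hφ : NormalizedByInn φ) (g : G) (b : B) :
    ∃ c : B, ∀ x : G, φ c x = g * φ b (g⁻¹ * x * g) * g⁻¹ := by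
  obtain ⟨c, hc⟩ := (hφ ⟨g, rfl⟩ (φ b)).1 ⟨b, rfl⟩
  exact ⟨c, fun x => by rw [hc]; simp [MulAut.mul_apply]⟩

theorem NormalizedByInn.of_exists_conj {φ : B →* MulAut G}
    (hφ : ∀ (g : G) (b : B), ∃ c : B, ∀ x : G, φ c x = g * φ b (g⁻¹ * x * g) * g⁻¹) :
    NormalizedByInn φ := by
  have key : ∀ (g : G) (f : MulAut G), f ∈ φ.range →
      MulAut.conj g * f * (MulAut.conj g)⁻¹ ∈ φ.range := by
    rintro g _ ⟨b, rfl⟩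
    obtain ⟨c, hc⟩ := hφ g b
    exact ⟨c, by ext x; rw [hc]; simp [MulAut.mul_apply]⟩
  rintro _ ⟨g, rfl⟩ f
  refine ⟨key g f, fun h => ?_⟩
  have := key g⁻¹ _ h
  simpa [mul_assoc] using this

theorem NormalizedByInn.quotientAction {φ : B →* MulAut G} (hφ : NormalizedByInn φ)
    (N : Subgroup G) [N.Normal] (h : IsInvariant φ N) :
    NormalizedByInn (quotientAction φ N h) := by
  refine NormalizedByInn.of_exists_conj fun q b => ?_
  induction q using QuotientGroup.induction_on with
  | H g =>
    obtain ⟨c, hc⟩ := hφ.exists_conj g b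
    refine ⟨c, fun x => ?_⟩
    induction x using QuotientGroup.induction_on with
    | H x => exact congrArg (QuotientGroup.mk (s := N)) (hc x)

theorem normalizedByInn_conj (G : Type u) [Group G] :
    NormalizedByInn (MulAut.conj : G →* MulAut G) :=
  NormalizedByInn.of_exists_conj fun g b => ⟨g * b * g⁻¹, fun x => by simp [mul_assoc]⟩

/-- The centralizer `C_G(B)` in `G` of an action of `B` on `G`. -/
def fixedSubgroup (φ : B →* MulAut G) : Subgroup G where
  carrier := {g | ∀ b, φ b g = g}
  mul_mem' hx hy b := by rw [map_mul, hx b, hy b]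
  one_mem' b := map_one _
  inv_mem' hx b := by rw [map_inv, hx b]

/-- The normal `B`-subgroups of `G`. -/
structure NormalInvariant (φ : B →* MulAut G) where
  toSubgroup : Subgroup G
  normal : toSubgroup.Normal
  invariant : IsInvariant φ toSubgroup

/-- The full preimage in `G` of `C_{G/N}(B)`. -/
def centerStep (φ : B →* MulAut G) (N : NormalInvariant φ) : Subgroup G :=
  haveI := N.normal
  (fixedSubgroup (quotientAction φ N.toSubgroup N.invariant)).comap
    (QuotientGroup.mk' N.toSubgroup)

theorem mem_centerStep (φ : B →* MulAut G) (N : NormalInvariant φ) (g : G) :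
    g ∈ centerStep φ N ↔ ∀ b, g⁻¹ * φ b g ∈ N.toSubgroup := by
  have := N.normal
  refine forall_congr' fun b => ?_
  change ((φ b g : G) : G ⧸ N.toSubgroup) = (g : G ⧸ N.toSubgroup) ↔ _
  rw [eq_comm, QuotientGroup.eq]

/-- The full preimage of `C_{G/N}(B)`, as a normal `B`-subgroup. -/
def nextCenter (φ : B →* MulAut G) (hφ : NormalizedByInn φ) (N : NormalInvariant φ) :
    NormalInvariant φ where
  toSubgroup := centerStep φ N
  normal := by
    have := N.normal
    refine ⟨fun g hg x => ?_⟩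
    rw [mem_centerStep] at hg ⊢
    intro b
    obtain ⟨c, hc⟩ := hφ.exists_conj x⁻¹ b
    have h1 := N.normal.conj_mem _ (hg c) x
    rw [hc] at h1
    simpa [mul_assoc] using h1
  invariant := by
    intro c g hg
    rw [mem_centerStep] at hg ⊢
    intro b
    have h1 := N.invariant c _ (hg (c⁻¹ * b * c))
    simpa [MulAut.mul_apply] using h1

/-- The trivial subgroup as a normal `B`-subgroup. -/
def trivialSubgroup (φ : B →* MulAut G) : NormalInvariant φ where
  toSubgroup := ⊥
  normal := inferInstance
  invariant b x hx := by
    rw [Subgroup.mem_bot] at hx ⊢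
    rw [hx, map_one]

/-- The subgroup generated by a family of normal `B`-subgroups
(the union, in the case of a nonempty chain). -/
def supSubgroup {φ : B →* MulAut G} {ι : Sort w} (N : ι → NormalInvariant φ) :
    NormalInvariant φ where
  toSubgroup := ⨆ i, (N i).toSubgroup
  normal := by
    have := fun i => (N i).normal
    infer_instance
  invariant b := by
    change (⨆ i, (N i).toSubgroup) ≤ (⨆ i, (N i).toSubgroup).comap ((φ b : G ≃* G) : G →* G)
    exact iSup_le fun i x hx =>
      (le_iSup (fun i => (N i).toSubgroup) i) ((N i).invariant b x hx)

/-- The ascending series `Z_α(G,B)` of `α`-th `B`-centers of `G`: `Z_0 = 1`,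
`Z_{α+1}/Z_α = C_{G/Z_α}(B)`, and `Z_λ = ⋃_{α<λ} Z_α` for a limit ordinal `λ`. -/
def centerSeries (φ : B →* MulAut G) (hφ : NormalizedByInn φ) (α : Ordinal.{w}) :
    NormalInvariant φ :=
  Ordinal.limitRecOn α (trivialSubgroup φ) (fun _ N => nextCenter φ hφ N)
    (fun l _ N => supSubgroup fun β : Set.Iio l => N β.1 β.2)

/-- The `B`-hypercenter `Z_∞(G,B)`, the last term of the ascending series `Z_α(G,B)`, that is,
the union of all its terms. The ordinals of the universe of `G` suffice for the series to
become stationary. -/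
def actionHypercenter (φ : B →* MulAut G) (hφ : NormalizedByInn φ) : Subgroup G :=
  ⨆ α : Ordinal.{u}, (centerSeries φ hφ α).toSubgroup

/-- `G` is `B`-hypercentral: `G = Z_α(G,B)` for some ordinal `α`. -/
def IsActionHypercentral (φ : B →* MulAut G) (hφ : NormalizedByInn φ) : Prop :=
  ∃ α : Ordinal.{u}, (centerSeries φ hφ α).toSubgroup = ⊤

end Action

/-- The hypercenter of a group: the last term of its transfinite upper central series,
obtained from the action of the group on itself by conjugation. -/
def hypercenter (G : Type u) [Group G] : Subgroup G :=
  actionHypercenter (MulAut.conj : G →* MulAut G) (normalizedByInn_conj G)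

end ActionHypercenter

end

open ActionHypercenter

/-!
Let `Z` be the hypercenter of the action.

Part (H). After dividing by `Z` the action has no nontrivial fixed points, so an element is
determined by its commutators with `B`. The elements of `B` that are hypercentral modulo inner
automorphisms and fix `L` pointwise form a subgroup `E` of bounded index, and an induction along
both central series shows that `E` fixes `C_G(L)` pointwise as well. The commutators `[g, B]` of an
element `g` of `C_G(L)` therefore generate an abelian group of bounded rank and of exponent dividing
`|L|`. So `C_G(L)` lies at bounded depth in the central series above `L`, and the map
`g ↦ (b ↦ [g, b])` on `B ⧸ E` bounds the order of each level.

Part (B). In the finite group `G ⧸ Z`, a minimal normal invariant subgroup `T` with hypercentral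
quotient satisfies `T = [T, B]`, so every element of `T` is a word in commutators of elements of `T`
with elements of `B`. Lifting these words to `G` gives a system of equations `x i = w i x` which,
by transfinite induction, has exactly one solution `l` lifting the elements of `T`. By uniqueness,
`l` is fixed by `Z` and by the elements of `B` that act trivially on `G ⧸ Z` and are hypercentral
modulo the kernel of the action; the latter have bounded index in `B` by part (H). Hence the normal
invariant closure `L` of `l` has boundedly many generators and is centralized by `Z`, and Schur's
theorem bounds its derived subgroup. With `n = [G : Z]`, the `n`-th power of `l` solves the system
in `G ⧸ [L, L]` and lies in the hypercenter there, so it equals the solution `1`, and the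
abelianization of `L` has exponent dividing `n`.
-/

namespace ActionHypercenter

section HypercentralOver

variable {G : Type*} [Group G] {B : Type*} [Group B] {φ : B →* MulAut G}

/-- The elements that are hypercentral relative to a subgroup `S`: the smallest class containing `S`
and every `g` all of whose commutators `[g, b] = g⁻¹ * φ b g` lie in the class. For `S = ⊥` it is
the hypercenter (`mem_actionHypercenter_iff`), without reference to ordinals. -/
inductive HypercentralOver (φ : B →* MulAut G) (S : Subgroup G) : G → Prop
  | of_mem {g : G} : g ∈ S → HypercentralOver φ S g
  | of_commutator {g : G} : (∀ b, HypercentralOver φ S (g⁻¹ * φ b g)) → HypercentralOver φ S g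

namespace HypercentralOver

theorem trans {S S' : Subgroup G} {g : G} (h : HypercentralOver φ S g)
    (hS : ∀ x ∈ S, HypercentralOver φ S' x) : HypercentralOver φ S' g := by
  induction h with
  | of_mem hg => exact hS _ hg
  | of_commutator _ ih => exact .of_commutator ih

theorem mono {S S' : Subgroup G} (hS : S ≤ S') {g : G} (h : HypercentralOver φ S g) :
    HypercentralOver φ S' g :=
  h.trans fun _ hx => .of_mem (hS hx)

theorem mem_of_forall_commutator {S N : Subgroup G} {g : G} (h : HypercentralOver φ S g)
    (hS : S ≤ N) (hN : ∀ x, (∀ b, x⁻¹ * φ b x ∈ N) → x ∈ N) : g ∈ N := by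
  induction h with
  | of_mem hg => exact hS hg
  | of_commutator _ ih => exact hN _ ih

variable {H : Type*} [Group H] {C : Type*} [Group C] {ψ : C →* MulAut H}

theorem map (f : G →* H) (hf : ∀ c g, ∃ b, ψ c (f g) = f (φ b g)) {S : Subgroup G}
    {S' : Subgroup H} (hS : S ≤ S'.comap f) {g : G} (h : HypercentralOver φ S g) :
    HypercentralOver ψ S' (f g) := by
  induction h with
  | of_mem hg => exact .of_mem (hS hg)
  | @of_commutator g _ ih =>
    refine .of_commutator fun c => ?_
    obtain ⟨b, hb⟩ := hf c g
    rw [hb, ← map_inv, ← map_mul]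
    exact ih b

theorem of_map (f : G →* H) (hf : ∀ b g, ∃ c, ψ c (f g) = f (φ b g)) {S : Subgroup G}
    {S' : Subgroup H} (hS : S'.comap f ≤ S) {g : G} (h : HypercentralOver ψ S' (f g)) :
    HypercentralOver φ S g := by
  generalize hx : f g = x at h
  induction h generalizing g with
  | of_mem h => exact .of_mem (hS (Subgroup.mem_comap.2 (hx ▸ h)))
  | of_commutator _ ih =>
    subst hx
    refine .of_commutator fun b => ?_
    obtain ⟨c, hc⟩ := hf b g
    exact ih c (by rw [hc, map_mul, map_inv])

end HypercentralOver

end HypercentralOver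

section CenterSeries

variable {G : Type u} [Group G] {B : Type v} [Group B] {φ : B →* MulAut G}
  (hφ : NormalizedByInn φ)

instance (N : NormalInvariant φ) : N.toSubgroup.Normal := N.normal

theorem centerSeries_zero : (centerSeries φ hφ (0 : Ordinal.{w})).toSubgroup = ⊥ := by
  rw [centerSeries, Ordinal.limitRecOn_zero]; rfl

theorem mem_centerSeries_succ (α : Ordinal.{w}) (g : G) :
    g ∈ (centerSeries φ hφ (α + 1)).toSubgroup ↔
      ∀ b, g⁻¹ * φ b g ∈ (centerSeries φ hφ α).toSubgroup := by
  rw [centerSeries, Ordinal.limitRecOn_add_one]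
  exact mem_centerStep φ _ g

theorem le_centerStep (N : NormalInvariant φ) : N.toSubgroup ≤ centerStep φ N := fun g hg =>
  (mem_centerStep φ N g).2 fun b => mul_mem (inv_mem hg) (N.invariant b g hg)

theorem centerSeries_limit {l : Ordinal.{w}} (hl : Order.IsSuccLimit l) :
    (centerSeries φ hφ l).toSubgroup =
      ⨆ β : Set.Iio l, (centerSeries φ hφ β.1).toSubgroup := by
  rw [centerSeries, Ordinal.limitRecOn_limit _ _ _ _ hl]; rfl

theorem centerSeries_mono : Monotone fun α : Ordinal.{w} => (centerSeries φ hφ α).toSubgroup := by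
  intro α β h
  induction β using Ordinal.limitRecOn with
  | zero => rw [nonpos_iff_eq_zero.1 h]
  | add_one β ih =>
    rcases h.eq_or_lt with rfl | h
    · rfl
    · exact (ih (Order.lt_add_one_iff.1 h)).trans fun g hg =>
        (mem_centerSeries_succ hφ β g).2 ((mem_centerStep φ _ g).1 (le_centerStep _ hg))
  | limit l hl ih =>
    rcases h.eq_or_lt with rfl | h
    · rfl
    · simp only [centerSeries_limit hφ hl]
      exact le_iSup (fun β : Set.Iio l => (centerSeries φ hφ β.1).toSubgroup) ⟨α, h⟩

theorem mem_centerSeries_limit {l : Ordinal.{w}} (hl : Order.IsSuccLimit l) (g : G) :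
    g ∈ (centerSeries φ hφ l).toSubgroup ↔
      ∃ β < l, g ∈ (centerSeries φ hφ β).toSubgroup := by
  have : Nonempty (Set.Iio l) := ⟨⟨0, hl.bot_lt⟩⟩
  rw [centerSeries_limit hφ hl, Subgroup.mem_iSup_of_directed]
  · simp only [Subtype.exists, Set.mem_Iio, exists_prop]
  · exact Monotone.directed_le fun a b hab => centerSeries_mono hφ hab

theorem exists_centerSeries_eq_actionHypercenter :
    ∃ α : Ordinal.{u}, (centerSeries φ hφ α).toSubgroup = actionHypercenter φ hφ := by
  have hmem : ∀ g : G, g ∈ actionHypercenter φ hφ →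
      ∃ α : Ordinal.{u}, g ∈ (centerSeries φ hφ α).toSubgroup := fun g hg =>
    (Subgroup.mem_iSup_of_directed (centerSeries_mono hφ).directed_le).1 hg
  choose! a ha using hmem
  exact ⟨⨆ g : G, a g, le_antisymm
    (le_iSup (fun α : Ordinal.{u} => (centerSeries φ hφ α).toSubgroup) _) fun g hg =>
      centerSeries_mono hφ (Ordinal.le_iSup a g) (ha g hg)⟩

/-- The hypercenter as a normal invariant subgroup. -/
noncomputable def hypercenterSubgroup : NormalInvariant φ :=
  supSubgroup fun α : Ordinal.{u} => centerSeries φ hφ α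

theorem hypercenterSubgroup_toSubgroup :
    (hypercenterSubgroup hφ).toSubgroup = actionHypercenter φ hφ := rfl

theorem centerStep_hypercenterSubgroup_le :
    centerStep φ (hypercenterSubgroup hφ) ≤ (hypercenterSubgroup hφ).toSubgroup := by
  intro g hg
  obtain ⟨α, hα⟩ := exists_centerSeries_eq_actionHypercenter hφ
  rw [mem_centerStep, hypercenterSubgroup_toSubgroup, ← hα, ← mem_centerSeries_succ] at hg
  exact le_iSup (fun α : Ordinal.{u} => (centerSeries φ hφ α).toSubgroup) _ hg

theorem hypercentralOver_of_mem_centerSeries (α : Ordinal.{w}) :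
    ∀ g ∈ (centerSeries φ hφ α).toSubgroup, HypercentralOver φ ⊥ g := by
  induction α using Ordinal.limitRecOn with
  | zero =>
    intro g hg
    exact .of_mem (centerSeries_zero hφ ▸ hg)
  | add_one α ih =>
    intro g hg
    exact .of_commutator fun b => ih _ ((mem_centerSeries_succ hφ α g).1 hg b)
  | limit l hl ih =>
    intro g hg
    obtain ⟨β, hβ, hg⟩ := (mem_centerSeries_limit hφ hl g).1 hg
    exact ih β hβ g hg

theorem mem_actionHypercenter_iff {g : G} :
    g ∈ actionHypercenter φ hφ ↔ HypercentralOver φ ⊥ g := by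
  constructor
  · obtain ⟨α, hα⟩ := exists_centerSeries_eq_actionHypercenter hφ
    rw [← hα]
    exact hypercentralOver_of_mem_centerSeries hφ α g
  · exact fun h => h.mem_of_forall_commutator bot_le fun x hx =>
      centerStep_hypercenterSubgroup_le hφ ((mem_centerStep φ _ x).2 hx)

theorem isActionHypercentral_iff :
    IsActionHypercentral φ hφ ↔ ∀ g, HypercentralOver φ ⊥ g := by
  constructor
  · rintro ⟨α, hα⟩ g
    exact hypercentralOver_of_mem_centerSeries hφ α g (hα ▸ Subgroup.mem_top g)
  · intro h
    obtain ⟨α, hα⟩ := exists_centerSeries_eq_actionHypercenter hφ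
    exact ⟨α, hα.trans (eq_top_iff.2 fun g _ => (mem_actionHypercenter_iff hφ).2 (h g))⟩

theorem hypercentralOver_quotientAction_iff (L : Subgroup G) [L.Normal] (hL : IsInvariant φ L)
    (g : G) : HypercentralOver (quotientAction φ L hL) ⊥ (g : G ⧸ L) ↔ HypercentralOver φ L g :=
  ⟨.of_map (QuotientGroup.mk' L) (fun b _ => ⟨b, rfl⟩)
    ((MonoidHom.comap_bot _).trans (QuotientGroup.ker_mk' L)).le,
   .map (QuotientGroup.mk' L) (fun b _ => ⟨b, rfl⟩)
    ((MonoidHom.comap_bot _).trans (QuotientGroup.ker_mk' L)).ge⟩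

theorem isActionHypercentral_quotientAction_iff (L : Subgroup G) [L.Normal]
    (hL : IsInvariant φ L) :
    IsActionHypercentral (quotientAction φ L hL) (hφ.quotientAction L hL) ↔
      ∀ g, HypercentralOver φ L g := by
  rw [isActionHypercentral_iff, QuotientGroup.mk_surjective.forall]
  exact forall_congr' (hypercentralOver_quotientAction_iff L hL)

end CenterSeries

section HypercenterMod

variable {B : Type*} [Group B]

/-- The preimage in `B` of the hypercenter of `B ⧸ N`. -/
noncomputable def hypercenterMod (N : Subgroup B) [N.Normal] : Subgroup B :=
  (hypercenter (B ⧸ N)).comap (QuotientGroup.mk' N)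

theorem mem_hypercenterMod {N : Subgroup B} [N.Normal] {b : B} :
    b ∈ hypercenterMod N ↔ HypercentralOver MulAut.conj N b := by
  rw [hypercenterMod, hypercenter, Subgroup.mem_comap, mem_actionHypercenter_iff]
  have hker : (⊥ : Subgroup (B ⧸ N)).comap (QuotientGroup.mk' N) = N :=
    (MonoidHom.comap_bot _).trans (QuotientGroup.ker_mk' N)
  constructor
  · exact .of_map (QuotientGroup.mk' N) (fun b _ => ⟨QuotientGroup.mk' N b, rfl⟩) hker.le
  · exact .map (QuotientGroup.mk' N)
      (QuotientGroup.mk_surjective.forall.2 fun b _ => ⟨b, rfl⟩) hker.ge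

instance (N : Subgroup B) [N.Normal] : (hypercenterMod N).Normal :=
  (hypercenterSubgroup (normalizedByInn_conj (B ⧸ N))).normal.comap _

theorem index_hypercenterMod (N : Subgroup B) [N.Normal] :
    (hypercenterMod N).index = (hypercenter (B ⧸ N)).index :=
  Subgroup.index_comap_of_surjective _ (QuotientGroup.mk'_surjective N)

theorem le_hypercenterMod (N : Subgroup B) [N.Normal] : N ≤ hypercenterMod N := fun _ hb =>
  mem_hypercenterMod.2 (.of_mem hb)

theorem hypercenterMod_mono {N N' : Subgroup B} [N.Normal] [N'.Normal] (h : N ≤ N') :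
    hypercenterMod N ≤ hypercenterMod N' := fun _ hb =>
  mem_hypercenterMod.2 ((mem_hypercenterMod.1 hb).mono h)

end HypercenterMod

section Action

variable {G : Type*} [Group G] {B : Type*} [Group B] {φ : B →* MulAut G}

theorem NormalizedByInn.exists_eq_conj_commutator (hφ : NormalizedByInn φ) (g : G) (b : B) :
    ∃ c, φ c = MulAut.conj (g⁻¹ * φ b g) := by
  obtain ⟨c, hc⟩ := hφ.exists_conj g⁻¹ b
  refine ⟨c * b⁻¹, MulEquiv.ext fun x => ?_⟩
  rw [map_mul, MulAut.mul_apply, hc]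
  simp [mul_assoc]

theorem mul_commutator (φ : B →* MulAut G) (g : G) (b : B) : g * (g⁻¹ * φ b g) = φ b g :=
  mul_inv_cancel_left g _

theorem commutator_mul_of_mem_fixedSubgroup (hφ : NormalizedByInn φ) {y : G}
    (hy : y ∈ fixedSubgroup φ) (x : G) (b : B) :
    (x * y)⁻¹ * φ b (x * y) = x⁻¹ * φ b x := by
  obtain ⟨c, hc⟩ := hφ.exists_eq_conj_commutator x b
  have hcomm : (x⁻¹ * φ b x) * y = y * (x⁻¹ * φ b x) := by
    have := hy c
    rwa [hc, MulAut.conj_apply, mul_inv_eq_iff_eq_mul] at this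
  calc (x * y)⁻¹ * φ b (x * y) = y⁻¹ * (x⁻¹ * φ b x * y) := by rw [map_mul, hy b]; group
    _ = x⁻¹ * φ b x := by rw [hcomm, inv_mul_cancel_left]

theorem commutator_injective (h : fixedSubgroup φ = ⊥) :
    Function.Injective fun (g : G) (b : B) => g⁻¹ * φ b g := by
  intro g g' hgg
  have hfixed : g' * g⁻¹ ∈ fixedSubgroup φ := fun b => by
    have hb : g⁻¹ * φ b g = g'⁻¹ * φ b g' := congrFun hgg b
    rw [map_mul, map_inv, ← mul_commutator φ g' b, ← hb]
    group
  rw [h, Subgroup.mem_bot, mul_inv_eq_one] at hfixed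
  exact hfixed.symm

theorem IsInvariant.commutator_mem {N : Subgroup G} (hN : IsInvariant φ N) {g : G} (hg : g ∈ N)
    (b : B) : g⁻¹ * φ b g ∈ N :=
  mul_mem (inv_mem hg) (hN b g hg)

theorem isInvariant_closure {s : Set G} (hs : ∀ b, ∀ x ∈ s, φ b x ∈ Subgroup.closure s) :
    IsInvariant φ (Subgroup.closure s) := fun b =>
  (Subgroup.closure_le ((Subgroup.closure s).comap (φ b : G →* G))).2 (hs b)

theorem IsInvariant.centralizer {N : Subgroup G} (hN : IsInvariant φ N) :
    IsInvariant φ (Subgroup.centralizer (N : Set G)) := fun b g hg => by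
  refine Subgroup.mem_centralizer_iff.2 fun l hl => ?_
  simpa using congrArg (φ b) (Subgroup.mem_centralizer_iff.1 hg _ (hN b⁻¹ l hl))

/-- The action on an invariant subgroup. -/
def restrictAction (φ : B →* MulAut G) (N : Subgroup G) (hN : IsInvariant φ N) :
    B →* MulAut N where
  toFun b := ((φ b).subgroupMap N).trans (MulEquiv.subgroupCongr (hN.map_eq b))
  map_one' := by ext; simp
  map_mul' a b := by ext; simp

theorem mem_ker_restrictAction {N : Subgroup G} {hN : IsInvariant φ N} {b : B} :
    b ∈ (restrictAction φ N hN).ker ↔ ∀ x ∈ N, φ b x = x := by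
  rw [MonoidHom.mem_ker, MulEquiv.ext_iff, Subtype.forall]
  exact forall₂_congr fun x hx => Subtype.ext_iff

theorem index_ker_le_factorial {Q : Type*} [Group Q] [Finite Q] (ψ : B →* MulAut Q) :
    ψ.ker.index ≤ (Nat.card Q).factorial := by
  rw [Subgroup.index_ker, ← Nat.card_perm]
  exact Nat.card_le_card_of_injective (fun σ : ψ.range => σ.1.toEquiv)
    (MulEquiv.toEquiv_injective.comp Subtype.val_injective)

theorem ker_conjNormal (N : Subgroup G) [N.Normal] :
    (MulAut.conjNormal : G →* MulAut N).ker = Subgroup.centralizer (N : Set G) := by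
  ext g
  rw [MonoidHom.mem_ker, MulEquiv.ext_iff, Subtype.forall, Subgroup.mem_centralizer_iff]
  refine forall₂_congr fun x hx => ?_
  rw [Subtype.ext_iff, MulAut.conjNormal_apply, MulAut.one_apply, mul_inv_eq_iff_eq_mul, eq_comm]

theorem apply_out_eq {E : Subgroup B} {g : G} (hE : ∀ e ∈ E, φ e g = g) (b : B) :
    φ (b : B ⧸ E).out g = φ b g := by
  obtain ⟨e, he⟩ := QuotientGroup.mk_out_eq_mul E b
  rw [he, map_mul, MulAut.mul_apply, hE e e.2]

end Action

section AbelianBound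

theorem card_le_pow_of_commute {K : Type*} [hK : Group K] (hcomm : ∀ x y : K, Commute x y)
    {s : Set K} (hs : s.Finite) (hgen : Subgroup.closure s = ⊤) {d : ℕ} (hd : 0 < d)
    (hpow : ∀ x ∈ s, x ^ d = 1) : Finite K ∧ Nat.card K ≤ d ^ s.ncard := by
  let _ : CommGroup K := { hK with mul_comm := hcomm }
  have hexp : ∀ x : K, x ^ d = 1 := fun x =>
    (Subgroup.closure_le (powMonoidHom d : K →* K).ker).2 hpow (hgen ▸ Subgroup.mem_top x)
  have hfg : Group.FG K := ⟨⟨hs.toFinset, by simpa using hgen⟩⟩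
  have hdvd := card_dvd_exponent_pow_rank' K hexp
  have hrank : Group.rank K ≤ s.ncard := by
    rw [Set.ncard_eq_toFinset_card s hs]
    exact Group.rank_le (by simpa using hgen)
  exact ⟨Nat.finite_of_card_ne_zero (ne_zero_of_dvd_ne_zero (pow_pos hd _).ne' hdvd),
    (Nat.le_of_dvd (pow_pos hd _) hdvd).trans (Nat.pow_le_pow_right hd hrank)⟩

theorem card_closure_le_pow {K : Type*} [Group K] {s : Set K} (hs : s.Finite)
    (hcomm : ∀ x ∈ s, ∀ y ∈ s, x * y = y * x) {d : ℕ} (hd : 0 < d) (hpow : ∀ x ∈ s, x ^ d = 1) :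
    Finite (Subgroup.closure s) ∧ Nat.card (Subgroup.closure s) ≤ d ^ s.ncard := by
  have hmem : s ⊆ Set.range (Subtype.val : Subgroup.closure s → K) := fun x hx =>
    ⟨⟨x, Subgroup.subset_closure hx⟩, rfl⟩
  rw [← Set.ncard_preimage_of_injective_subset_range Subtype.val_injective hmem]
  exact card_le_pow_of_commute
    (fun x y => (Subgroup.isMulCommutative_closure hcomm).is_comm.comm x y)
    (hs.preimage Subtype.val_injective.injOn) Subgroup.closure_closure_coe_preimage hd
    fun x hx => Subtype.ext (hpow x.1 hx)

end AbelianBound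

section HypercentralFixer

variable {G : Type*} [Group G] {B : Type*} [Group B] {φ : B →* MulAut G}

/-- The elements of `B` that are hypercentral modulo inner automorphisms and fix `L` pointwise. -/
noncomputable def hypercentralFixer (φ : B →* MulAut G) (L : NormalInvariant φ) : Subgroup B :=
  hypercenterMod ((inn G).comap φ) ⊓ (restrictAction φ L.toSubgroup L.invariant).ker

variable {L : NormalInvariant φ}

instance normal_hypercentralFixer : (hypercentralFixer φ L).Normal :=
  inferInstanceAs (_ ⊓ _ : Subgroup B).Normal

instance [Finite L.toSubgroup] [(hypercenterMod ((inn G).comap φ)).FiniteIndex] :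
    (hypercentralFixer φ L).FiniteIndex :=
  inferInstanceAs (_ ⊓ _ : Subgroup B).FiniteIndex

theorem index_hypercentralFixer_le [Finite L.toSubgroup] :
    (hypercentralFixer φ L).index ≤
      (hypercenterMod ((inn G).comap φ)).index * (Nat.card L.toSubgroup).factorial :=
  Subgroup.index_inf_le.trans (Nat.mul_le_mul_left _ (index_ker_le_factorial _))

theorem mem_hypercentralFixer_of_eq_conj {n : G}
    (hn : n ∈ Subgroup.centralizer (L.toSubgroup : Set G)) {b : B} (hb : φ b = MulAut.conj n) :
    b ∈ hypercentralFixer φ L := by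
  refine ⟨le_hypercenterMod _ ⟨n, hb.symm⟩, mem_ker_restrictAction.2 fun x hx => ?_⟩
  rw [hb, MulAut.conj_apply, ← Subgroup.mem_centralizer_iff.1 hn x hx, mul_inv_cancel_right]

theorem HypercentralOver.of_eq_conj {N : Subgroup G} {g : G} (hg : HypercentralOver φ N g) {b : B}
    (hb : φ b = MulAut.conj g) : HypercentralOver MulAut.conj ((N.map MulAut.conj).comap φ) b := by
  have hconj : HypercentralOver ((MulAut.conj : MulAut G →* _).comp φ) (N.map MulAut.conj)
      (MulAut.conj g) :=
    hg.map MulAut.conj (fun c x => ⟨c, MulEquiv.ext fun y => by simp⟩) (Subgroup.le_comap_map _ _)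
  exact .of_map φ (fun c x => ⟨c, by simp⟩) le_rfl (hb ▸ hconj)

theorem hypercentralOver_comap_map_conj {N : Subgroup G} (hN : ∀ g, HypercentralOver φ N g) {b : B}
    (hb : b ∈ hypercenterMod ((inn G).comap φ)) :
    HypercentralOver MulAut.conj ((N.map MulAut.conj).comap φ) b :=
  (mem_hypercenterMod.1 hb).trans fun _ ⟨g, hg⟩ => (hN g).of_eq_conj hg.symm

/-- A three-subgroups argument: `[g, e]` is fixed by `B`, hence trivial. -/
theorem apply_eq_self_of_commutators (hφ : NormalizedByInn φ) (hfix : fixedSubgroup φ = ⊥)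
    {g : G} (hg : g ∈ Subgroup.centralizer (L.toSubgroup : Set G))
    (hcomm : ∀ b, ∀ e ∈ hypercentralFixer φ L, φ e (g⁻¹ * φ b g) = g⁻¹ * φ b g)
    {e : B} (he : e ∈ hypercentralFixer φ L) (h : ∀ b, φ (e⁻¹ * MulAut.conj b e) g = g) :
    φ e g = g := by
  suffices g⁻¹ * φ e g ∈ fixedSubgroup φ by
    rw [hfix, Subgroup.mem_bot, inv_mul_eq_one] at this
    exact this.symm
  intro b
  set n := g⁻¹ * φ b g with hn
  obtain ⟨c, hc⟩ := hφ.exists_eq_conj_commutator g b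
  have hcfix : n * (g⁻¹ * φ e g) * n⁻¹ = g⁻¹ * φ e g := by
    rw [← MulAut.conj_apply, ← hc]
    exact hcomm e c
      (mem_hypercentralFixer_of_eq_conj (L.invariant.centralizer.commutator_mem hg b) hc)
  have hconj : φ (MulAut.conj b e) g = φ e g := by
    rw [← mul_inv_cancel_left e (MulAut.conj b e), map_mul, MulAut.mul_apply, h b]
  have hbe : φ b (φ e g) = φ e g * n :=
    calc φ b (φ e g) = φ (MulAut.conj b e) (φ b g) := by simp
      _ = φ e g * n := by
        rw [← mul_commutator φ g b, map_mul, hconj,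
          hcomm b (MulAut.conj b e) (normal_hypercentralFixer.conj_mem e he b)]
  calc φ b (g⁻¹ * φ e g) = n⁻¹ * (g⁻¹ * φ e g) * n := by
        rw [map_mul, map_inv, hbe, ← mul_commutator φ g b, ← hn]; group
    _ = n⁻¹ * (n * (g⁻¹ * φ e g) * n⁻¹) * n := by rw [hcfix]
    _ = g⁻¹ * φ e g := by group

theorem hypercentralFixer_fixes_centralizer (hφ : NormalizedByInn φ) (hfix : fixedSubgroup φ = ⊥)
    (hL : ∀ g, HypercentralOver φ L.toSubgroup g) {g : G}
    (hg : g ∈ Subgroup.centralizer (L.toSubgroup : Set G)) :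
    ∀ e ∈ hypercentralFixer φ L, φ e g = g := by
  induction hL g with
  | of_mem h => exact fun e he => mem_ker_restrictAction.1 he.2 _ h
  | @of_commutator g _ ih =>
    intro e he
    induction hypercentralOver_comap_map_conj hL he.1 with
    | of_mem h =>
      obtain ⟨l, hl, hel⟩ := h
      rw [← hel, MulAut.conj_apply, Subgroup.mem_centralizer_iff.1 hg l hl, mul_inv_cancel_right]
    | @of_commutator e _ ihe =>
      exact apply_eq_self_of_commutators hφ hfix hg
        (fun b => ih b (L.invariant.centralizer.commutator_mem hg b)) he fun b =>
        ihe b (mul_mem (inv_mem he)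
          (normal_hypercentralFixer.conj_mem e he b))

theorem commute_commutator_of_mem_centralizer (hφ : NormalizedByInn φ)
    (hfix : fixedSubgroup φ = ⊥) (hL : ∀ g, HypercentralOver φ L.toSubgroup g) {g h : G}
    (hg : g ∈ Subgroup.centralizer (L.toSubgroup : Set G))
    (hh : h ∈ Subgroup.centralizer (L.toSubgroup : Set G)) (b : B) : Commute (h⁻¹ * φ b h) g := by
  obtain ⟨c, hc⟩ := hφ.exists_eq_conj_commutator h b
  have := hypercentralFixer_fixes_centralizer hφ hfix hL hg c
    (mem_hypercentralFixer_of_eq_conj (L.invariant.centralizer.commutator_mem hh b) hc)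
  rwa [hc, MulAut.conj_apply, mul_inv_eq_iff_eq_mul] at this

theorem pow_card_eq_one_of_mem_centralizer (hφ : NormalizedByInn φ) (hfix : fixedSubgroup φ = ⊥)
    (hL : ∀ g, HypercentralOver φ L.toSubgroup g) {g : G}
    (hg : g ∈ Subgroup.centralizer (L.toSubgroup : Set G)) :
    g ^ Nat.card L.toSubgroup = 1 := by
  induction hL g with
  | @of_mem g h => exact congrArg Subtype.val (pow_card_eq_one' (x := (⟨g, h⟩ : L.toSubgroup)))
  | @of_commutator g _ ih =>
    suffices g ^ Nat.card L.toSubgroup ∈ fixedSubgroup φ by rwa [hfix, Subgroup.mem_bot] at this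
    intro b
    rw [map_pow, ← mul_commutator φ g b,
      (commute_commutator_of_mem_centralizer hφ hfix hL hg hg b).symm.mul_pow,
      ih b (L.invariant.centralizer.commutator_mem hg b), mul_one]

end HypercentralFixer

section FiniteSeries

variable {G : Type*} [Group G] {B : Type*} [Group B] {φ : B →* MulAut G}
  (hφ : NormalizedByInn φ) (L : NormalInvariant φ)

/-- The preimage in `G` of the `m`-th term of the ascending central series of `G ⧸ L`. -/
noncomputable def iteratedCenter (m : ℕ) : NormalInvariant φ :=
  (nextCenter φ hφ)^[m] L

theorem iteratedCenter_succ (m : ℕ) :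
    iteratedCenter hφ L (m + 1) = nextCenter φ hφ (iteratedCenter hφ L m) :=
  Function.iterate_succ_apply' ..

theorem mem_iteratedCenter_succ {m : ℕ} {g : G} :
    g ∈ (iteratedCenter hφ L (m + 1)).toSubgroup ↔
      ∀ b, g⁻¹ * φ b g ∈ (iteratedCenter hφ L m).toSubgroup := by
  rw [iteratedCenter_succ]
  exact mem_centerStep φ _ g

theorem iteratedCenter_mono : Monotone fun m => (iteratedCenter hφ L m).toSubgroup :=
  monotone_nat_of_le_succ fun m => by
    rw [iteratedCenter_succ]
    exact le_centerStep _

theorem le_iteratedCenter_card {V : Subgroup G} [Finite V] (hV : IsInvariant φ V)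
    (hVL : ∀ g ∈ V, HypercentralOver φ L.toSubgroup g) :
    V ≤ (iteratedCenter hφ L (Nat.card V)).toSubgroup := by
  let U (m : ℕ) : Subgroup G := V ⊓ (iteratedCenter hφ L m).toSubgroup
  have hU : Monotone U := fun m n h => inf_le_inf_left V (iteratedCenter_mono hφ L h)
  have hfin (m : ℕ) : Finite (U m) := Finite.Set.subset (V : Set G) inf_le_left
  have heq {m : ℕ} (h : Nat.card (U m) = Nat.card (U (m + 1))) : U m = U (m + 1) :=
    Subgroup.eq_of_le_of_card_ge (hU m.le_succ) h.ge
  have hstab : Nat.card (U (Nat.card V + 1)) = Nat.card (U (Nat.card V)) := by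
    refine Nat.stabilises_of_monotone (fun m n h => Subgroup.card_le_of_le (hU h))
      (fun m => Subgroup.card_le_of_le inf_le_left) (fun m h => ?_) (Nat.le_succ _)
    have hmem (g : G) (hg : g ∈ V) : g ∈ (iteratedCenter hφ L (m + 1)).toSubgroup ↔
        g ∈ (iteratedCenter hφ L (m + 2)).toSubgroup := by
      rw [mem_iteratedCenter_succ, mem_iteratedCenter_succ]
      exact forall_congr' fun b =>
        ⟨fun hb => iteratedCenter_mono hφ L m.le_succ hb,
          fun hb => (heq h ▸ ⟨hV.commutator_mem hg b, hb⟩ : _ ∈ U m).2⟩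
    exact congrArg (fun W : Subgroup G => Nat.card W)
      (Subgroup.ext fun g => and_congr_right (hmem g))
  intro g hg
  induction hVL g hg with
  | of_mem h => exact iteratedCenter_mono hφ L (Nat.zero_le _) h
  | @of_commutator g _ ih =>
    have hsucc : g ∈ U (Nat.card V + 1) :=
      ⟨hg, (mem_iteratedCenter_succ hφ L).2 fun b => ih b (hV.commutator_mem hg b)⟩
    exact (heq hstab.symm ▸ hsucc).2

end FiniteSeries

section IndexBound

variable {G : Type*} [Group G] {B : Type*} [Group B] {φ : B →* MulAut G}

theorem card_inf_iteratedCenter_le (hφ : NormalizedByInn φ) (hfix : fixedSubgroup φ = ⊥)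
    (L : NormalInvariant φ) [Finite L.toSubgroup] {C : Subgroup G} (hC : IsInvariant φ C)
    {E : Subgroup B} [E.FiniteIndex] (hE : ∀ g ∈ C, ∀ e ∈ E, φ e g = g) (m : ℕ) :
    Finite (C ⊓ (iteratedCenter hφ L m).toSubgroup : Subgroup G) ∧
      Nat.card (C ⊓ (iteratedCenter hφ L m).toSubgroup : Subgroup G) ≤
        Nat.card L.toSubgroup ^ E.index ^ m := by
  induction m with
  | zero =>
    rw [pow_zero, pow_one]
    exact ⟨Finite.Set.subset (L.toSubgroup : Set G) inf_le_right,
      Subgroup.card_le_of_le (H := C ⊓ L.toSubgroup) inf_le_right⟩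
  | succ m ih =>
    obtain ⟨hfin, hcard⟩ := ih
    let f (g : (C ⊓ (iteratedCenter hφ L (m + 1)).toSubgroup : Subgroup G)) (q : B ⧸ E) :
        (C ⊓ (iteratedCenter hφ L m).toSubgroup : Subgroup G) :=
      ⟨g.1⁻¹ * φ q.out g.1, hC.commutator_mem g.2.1 _, (mem_iteratedCenter_succ hφ L).1 g.2.2 _⟩
    have hf : Function.Injective f := by
      intro g g' hgg
      refine Subtype.ext (commutator_injective hfix (funext fun b => ?_))
      have hb := congrArg Subtype.val (congrFun hgg b)
      change g.1⁻¹ * φ _ g.1 = g'.1⁻¹ * φ _ g'.1 at hb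
      rwa [apply_out_eq (hE _ g.2.1), apply_out_eq (hE _ g'.2.1)] at hb
    refine ⟨Finite.of_injective f hf, (Nat.card_le_card_of_injective f hf).trans ?_⟩
    rw [Nat.card_fun, ← Subgroup.index, pow_succ, pow_mul]
    exact Nat.pow_le_pow_left hcard _

variable {L : NormalInvariant φ} [Finite L.toSubgroup]
  [(hypercenterMod ((inn G).comap φ)).FiniteIndex]

theorem centralizer_le_iteratedCenter (hφ : NormalizedByInn φ) (hfix : fixedSubgroup φ = ⊥)
    (hL : ∀ g, HypercentralOver φ L.toSubgroup g) :
    Subgroup.centralizer (L.toSubgroup : Set G) ≤ (iteratedCenter hφ L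
      (Nat.card L.toSubgroup ^ (hypercentralFixer φ L).index + 1)).toSubgroup := by
  intro g hg
  rw [mem_iteratedCenter_succ]
  intro b
  set y := g⁻¹ * φ b g with hy
  have hyC := L.invariant.centralizer.commutator_mem hg b
  set s := Set.range fun c => φ c y with hs
  have hsC : ∀ x ∈ s, x ∈ Subgroup.centralizer (L.toSubgroup : Set G) := by
    rintro _ ⟨c, rfl⟩
    exact L.invariant.centralizer c y hyC
  have hsout : s = Set.range fun q : B ⧸ hypercentralFixer φ L => φ q.out y := by
    rw [hs, ← QuotientGroup.mk_surjective.range_comp]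
    exact congrArg Set.range (funext fun c => (apply_out_eq
      (hypercentralFixer_fixes_centralizer hφ hfix hL hyC) c).symm)
  have hsfin : s.Finite := hsout ▸ Set.finite_range _
  have hscard : s.ncard ≤ (hypercentralFixer φ L).index := by
    rw [hsout, ← Nat.card_coe_set_eq]
    exact Finite.card_range_le _
  -- `φ c y` is a commutator `[φ c g, c * b * c⁻¹]`, and these commute with the centralizer of `L`.
  have hscomm : ∀ x ∈ s, ∀ z ∈ s, x * z = z * x := by
    rintro _ ⟨c, rfl⟩ z hz
    have := commute_commutator_of_mem_centralizer hφ hfix hL (hsC z hz)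
      (L.invariant.centralizer c g hg) (c * b * c⁻¹)
    simpa [hy] using this.eq
  obtain ⟨hVfin, hVcard⟩ := card_closure_le_pow hsfin hscomm Nat.card_pos fun x hx =>
    pow_card_eq_one_of_mem_centralizer hφ hfix hL (hsC x hx)
  have hVinv : IsInvariant φ (Subgroup.closure s) := isInvariant_closure <| by
    rintro c _ ⟨a, rfl⟩
    exact Subgroup.subset_closure ⟨c * a, by simp⟩
  refine iteratedCenter_mono hφ L (hVcard.trans (Nat.pow_le_pow_right Nat.card_pos hscard))
    (le_iteratedCenter_card hφ L hVinv (fun x _ => hL x) ?_)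
  exact Subgroup.subset_closure ⟨1, by simp⟩

theorem finite_and_card_le_of_fixedSubgroup_eq_bot (hφ : NormalizedByInn φ)
    (hfix : fixedSubgroup φ = ⊥) (hL : ∀ g, HypercentralOver φ L.toSubgroup g) {d n : ℕ}
    (hd : Nat.card L.toSubgroup = d) (hn : (hypercentralFixer φ L).index = n) :
    Finite G ∧ Nat.card G ≤ d ^ n ^ (d ^ n + 1) * d.factorial := by
  obtain ⟨hfin, hcard⟩ := card_inf_iteratedCenter_le hφ hfix L L.invariant.centralizer
    (fun _ hg => hypercentralFixer_fixes_centralizer hφ hfix hL hg)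
    (Nat.card L.toSubgroup ^ (hypercentralFixer φ L).index + 1)
  rw [inf_eq_left.2 (centralizer_le_iteratedCenter hφ hfix hL)] at hfin hcard
  have hmul := Subgroup.card_mul_index (Subgroup.centralizer (L.toSubgroup : Set G))
  rw [← ker_conjNormal L.toSubgroup] at hmul hcard hfin
  refine ⟨Nat.finite_of_card_ne_zero ?_, ?_⟩
  · rw [← hmul]
    exact mul_ne_zero Nat.card_pos.ne' Subgroup.FiniteIndex.index_ne_zero
  · rw [← hmul, ← hd, ← hn]
    exact Nat.mul_le_mul hcard (index_ker_le_factorial _)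

/-- The bound in part (H) for the index of the hypercenter, where `d` is the order of a normal
invariant subgroup with hypercentral quotient and `k` is the index of the hypercenter of `B` modulo
inner automorphisms. -/
def hypercenterIndexBound (d k : ℕ) : ℕ :=
  let n := k * d.factorial
  d ^ n ^ (d ^ n + 1) * d.factorial

theorem pow_pow_mul_factorial_le_hypercenterIndexBound {d n d' k : ℕ} (hd : 0 < d) (hn : 0 < n)
    (hdd : d ≤ d') (hnk : n ≤ k * d'.factorial) :
    d ^ n ^ (d ^ n + 1) * d.factorial ≤ hypercenterIndexBound d' k := by
  have hd' : 1 ≤ d' := hd.trans_le hdd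
  have hn' : 1 ≤ k * d'.factorial := hn.trans_le hnk
  dsimp only [hypercenterIndexBound]
  calc d ^ n ^ (d ^ n + 1) * d.factorial
      ≤ d' ^ n ^ (d' ^ n + 1) * d'.factorial := by gcongr
    _ ≤ d' ^ (k * d'.factorial) ^ (d' ^ (k * d'.factorial) + 1) * d'.factorial := by gcongr

theorem finiteIndex_and_index_le_of_relIndex (hφ : NormalizedByInn φ) {Z N : NormalInvariant φ}
    (hZ : centerStep φ Z ≤ Z.toSubgroup) (hN : ∀ g, HypercentralOver φ N.toSubgroup g) {d k : ℕ}
    (hd0 : Z.toSubgroup.relIndex N.toSubgroup ≠ 0) (hd : Z.toSubgroup.relIndex N.toSubgroup ≤ d)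
    (hk : (hypercenterMod ((inn G).comap φ)).index ≤ k) :
    Z.toSubgroup.FiniteIndex ∧ Z.toSubgroup.index ≤ hypercenterIndexBound d k := by
  let φZ := quotientAction φ Z.toSubgroup Z.invariant
  let π := QuotientGroup.mk' Z.toSubgroup
  let NZ : NormalInvariant φZ :=
    { toSubgroup := N.toSubgroup.map π
      normal := N.normal.map π (QuotientGroup.mk'_surjective _)
      invariant := by
        rintro b _ ⟨x, hx, rfl⟩
        exact ⟨φ b x, N.invariant b x hx, rfl⟩ }
  have hcard : Nat.card NZ.toSubgroup = Z.toSubgroup.relIndex N.toSubgroup := by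
    rw [← Subgroup.relIndex_ker, QuotientGroup.ker_mk']
  have : Finite NZ.toSubgroup := Nat.finite_of_card_ne_zero (hcard ▸ hd0)
  have hfix : fixedSubgroup φZ = ⊥ := by
    refine eq_bot_iff.2 (QuotientGroup.mk_surjective.forall.2 fun g hg => ?_)
    exact (QuotientGroup.eq_one_iff g).2 (hZ hg)
  have hNZ : ∀ q, HypercentralOver φZ NZ.toSubgroup q := QuotientGroup.mk_surjective.forall.2
    fun g => (hN g).map π (fun b _ => ⟨b, rfl⟩) (Subgroup.le_comap_map _ _)
  have hinn : (inn G).comap φ ≤ (inn (G ⧸ Z.toSubgroup)).comap φZ := fun b ⟨g, hg⟩ =>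
    ⟨(g : G ⧸ Z.toSubgroup), MulEquiv.ext <| QuotientGroup.mk_surjective.forall.2 fun x =>
      congrArg π (DFunLike.congr_fun hg x)⟩
  have hfin := Subgroup.finiteIndex_of_le (hypercenterMod_mono hinn)
  obtain ⟨hG, hcardG⟩ := finite_and_card_le_of_fixedSubgroup_eq_bot
    (hφ.quotientAction _ Z.invariant) hfix hNZ rfl rfl
  refine ⟨Subgroup.finiteIndex_of_finite_quotient, hcardG.trans ?_⟩
  refine pow_pow_mul_factorial_le_hypercenterIndexBound Nat.card_pos
    (Nat.pos_of_ne_zero Subgroup.FiniteIndex.index_ne_zero) (hcard ▸ hd)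
    (index_hypercentralFixer_le.trans (Nat.mul_le_mul ?_ (Nat.factorial_le (hcard ▸ hd))))
  exact (Subgroup.index_antitone (hypercenterMod_mono hinn)).trans hk

end IndexBound

section KernelBound

variable {G : Type*} [Group G] {B : Type*} [Group B] {φ : B →* MulAut G}

theorem normalizedByInn_conjNormal (N : Subgroup B) [N.Normal] :
    NormalizedByInn (MulAut.conjNormal : B →* MulAut N) :=
  .of_exists_conj fun h b => ⟨h * b * (h : B)⁻¹, fun x => Subtype.ext <| by
    simp [MulAut.conjNormal_apply, mul_assoc]⟩

theorem relIndex_hypercenterMod_ker (hφ : NormalizedByInn φ)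
    [(actionHypercenter φ hφ).FiniteIndex] :
    (hypercenterMod φ.ker).relIndex ((inn G).comap φ) ≠ 0 ∧
      (hypercenterMod φ.ker).relIndex ((inn G).comap φ) ≤ (actionHypercenter φ hφ).index := by
  set P := (actionHypercenter φ hφ).map (MulAut.conj : G →* MulAut G) with hP
  have hle : P.comap φ ≤ hypercenterMod φ.ker := fun b ⟨z, hz, hzb⟩ => by
    have := ((mem_actionHypercenter_iff hφ).1 hz).of_eq_conj hzb.symm
    rw [Subgroup.map_bot, MonoidHom.comap_bot] at this
    exact mem_hypercenterMod.2 this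
  have hinn : P.relIndex (inn G) ∣ (actionHypercenter φ hφ).index := by
    rw [hP, inn, MonoidHom.range_eq_map, Subgroup.relIndex_map_map, top_sup_eq,
      Subgroup.relIndex_top_right]
    exact Subgroup.index_dvd_of_le le_sup_left
  have hinn0 : P.relIndex (inn G) ≠ 0 :=
    ne_zero_of_dvd_ne_zero Subgroup.FiniteIndex.index_ne_zero hinn
  have hmap : ((inn G).comap φ).map φ ≤ inn G := Subgroup.map_comap_le φ (inn G)
  have hcomap0 : (P.comap φ).relIndex ((inn G).comap φ) ≠ 0 := by
    rw [Subgroup.relIndex_comap]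
    exact mt (Subgroup.relIndex_eq_zero_of_le_right hmap) hinn0
  refine ⟨mt (Subgroup.relIndex_eq_zero_of_le_left hle) hcomap0, ?_⟩
  calc (hypercenterMod φ.ker).relIndex ((inn G).comap φ)
      ≤ (P.comap φ).relIndex ((inn G).comap φ) := Subgroup.relIndex_le_of_le_left hle hcomap0
    _ ≤ P.relIndex (inn G) := by
      rw [Subgroup.relIndex_comap]
      exact Subgroup.relIndex_le_of_le_right hmap hinn0
    _ ≤ (actionHypercenter φ hφ).index :=
      Nat.le_of_dvd (Nat.pos_of_ne_zero Subgroup.FiniteIndex.index_ne_zero) hinn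

/-- Apply part (H) to the conjugation action of `B` on the preimage of the hypercenter of
`B ⧸ φ⁻¹(Inn G)`. -/
theorem finiteIndex_and_index_hypercenterMod_ker_le (hφ : NormalizedByInn φ)
    [(actionHypercenter φ hφ).FiniteIndex] [(hypercenterMod ((inn G).comap φ)).FiniteIndex] :
    (hypercenterMod φ.ker).FiniteIndex ∧ (hypercenterMod φ.ker).index ≤
      hypercenterIndexBound (actionHypercenter φ hφ).index (hypercenterMod ((inn G).comap φ)).index
        * (hypercenterMod ((inn G).comap φ)).index := by
  set D := (inn G).comap φ
  set H := hypercenterMod D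
  have hkerH : hypercenterMod φ.ker ≤ H := hypercenterMod_mono (Subgroup.ker_le_comap _ _)
  let ψ : B →* MulAut H := MulAut.conjNormal
  let restrict (N : Subgroup B) (hN : N.Normal) : NormalInvariant ψ :=
    { toSubgroup := N.subgroupOf H
      normal := hN.subgroupOf H
      invariant := fun b x hx => hN.conj_mem x hx b }
  have hHinn : H ≤ (inn H).comap ψ := fun h hh =>
    ⟨⟨h, hh⟩, MulEquiv.ext fun x => Subtype.ext (by simp [ψ, MulAut.conjNormal_apply])⟩
  have hHk := hHinn.trans (le_hypercenterMod _)
  have := Subgroup.finiteIndex_of_le hHk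
  have hrel : ((hypercenterMod φ.ker).subgroupOf H).relIndex (D.subgroupOf H) =
      (hypercenterMod φ.ker).relIndex D := Subgroup.relIndex_subgroupOf (le_hypercenterMod D)
  obtain ⟨h0, hle⟩ := relIndex_hypercenterMod_ker hφ
  rw [← hrel] at h0 hle
  have hclosed : centerStep ψ (restrict (hypercenterMod φ.ker) inferInstance) ≤
      (hypercenterMod φ.ker).subgroupOf H := fun x hx =>
    mem_hypercenterMod.2 <| .of_commutator fun b =>
      mem_hypercenterMod.1 ((mem_centerStep ψ _ x).1 hx b)
  have hover (x : H) : HypercentralOver ψ (D.subgroupOf H) x :=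
    .of_map H.subtype (fun b _ => ⟨b, rfl⟩) le_rfl (mem_hypercenterMod.1 x.2)
  obtain ⟨hfin, hindex⟩ := finiteIndex_and_index_le_of_relIndex (normalizedByInn_conjNormal H)
    (Z := restrict (hypercenterMod φ.ker) inferInstance) (N := restrict D inferInstance)
    hclosed hover h0 hle (Subgroup.index_antitone hHk)
  have hmul := Subgroup.relIndex_mul_index hkerH
  refine ⟨⟨?_⟩, ?_⟩
  · rw [← hmul]
    exact mul_ne_zero hfin.index_ne_zero Subgroup.FiniteIndex.index_ne_zero
  · rw [← hmul]
    exact Nat.mul_le_mul_right _ hindex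

end KernelBound

section CommutatorWord

variable {G : Type*} [Group G] {B : Type*} [Group B] {φ : B →* MulAut G} {ι : Type*}

/-- The product of the commutators `[x i, b] = (x i)⁻¹ * φ b (x i)` over the letters `(i, b)` of
`w`. -/
def commWord (φ : B →* MulAut G) (w : List (ι × B)) (x : ι → G) : G :=
  (w.map fun p => (x p.1)⁻¹ * φ p.2 (x p.1)).prod

/-- The map `x ↦ (commWord φ (w i) x)_i`; its fixed points are the solutions of the system of
commutator equations `x i = commWord φ (w i) x`. -/
def commMap (φ : B →* MulAut G) (w : ι → List (ι × B)) (x : ι → G) (i : ι) : G :=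
  commWord φ (w i) x

theorem map_commWord {H : Type*} [Group H] {C : Type*} [Group C] {ψ : C →* MulAut H} (f : G →* H)
    (θ : B → C) {x : ι → G} (h : ∀ i b, ψ (θ b) (f (x i)) = f (φ b (x i))) (w : List (ι × B)) :
    f (commWord φ w x) = commWord ψ (w.map (Prod.map id θ)) (fun i => f (x i)) := by
  rw [commWord, commWord, map_list_prod, List.map_map, List.map_map]
  exact congrArg List.prod (List.map_congr_left fun p _ => by simp [h])

theorem mk_commWord {N : Subgroup G} [N.Normal] (hN : IsInvariant φ N) (w : List (ι × B))
    (x : ι → G) :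
    ((commWord φ w x : G) : G ⧸ N) = commWord (quotientAction φ N hN) w fun i => (x i : G ⧸ N) := by
  simpa using map_commWord (ψ := quotientAction φ N hN) (QuotientGroup.mk' N) id
    (fun _ _ => rfl) w

theorem commWord_one (w : List (ι × B)) : commWord φ w (fun _ => 1) = 1 := by
  simp [commWord]

theorem commWord_pow {M : Subgroup G} (hM : IsInvariant φ M)
    (hcomm : ∀ x ∈ M, ∀ y ∈ M, Commute x y) {x : ι → G} (hx : ∀ i, x i ∈ M) (w : List (ι × B))
    (n : ℕ) : commWord φ w (fun i => x i ^ n) = commWord φ w x ^ n := by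
  have hterm (p : ι × B) : (x p.1)⁻¹ * φ p.2 (x p.1) ∈ M := hM.commutator_mem (hx _) _
  induction w with
  | nil => simp [commWord]
  | cons p w ih =>
    have hw : (w.map fun p => (x p.1)⁻¹ * φ p.2 (x p.1)).prod ∈ M :=
      Subgroup.list_prod_mem _ <| List.forall_mem_map.2 fun p _ => hterm p
    simp only [commWord, List.map_cons, List.prod_cons] at ih ⊢
    rw [ih, (hcomm _ (hterm p) _ hw).mul_pow,
      (hcomm _ (inv_mem (hx _)) _ (hM _ _ (hx _))).mul_pow, map_pow, inv_pow]

theorem commWord_inv_mul_mem (hφ : NormalizedByInn φ) {N : NormalInvariant φ} {x x' : ι → G}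
    (h : ∀ i, (x i)⁻¹ * x' i ∈ centerStep φ N) (w : List (ι × B)) :
    (commWord φ w x)⁻¹ * commWord φ w x' ∈ N.toSubgroup := by
  rw [← QuotientGroup.eq, mk_commWord N.invariant, mk_commWord N.invariant]
  refine congrArg List.prod (List.map_congr_left fun p _ => ?_)
  dsimp only
  rw [← mul_inv_cancel_left (x p.1) (x' p.1), QuotientGroup.mk_mul]
  exact (commutator_mul_of_mem_fixedSubgroup (hφ.quotientAction _ N.invariant) (h p.1) _ _).symm

end CommutatorWord

section FixedPoint

variable {G : Type u} [Group G] {B : Type*} [Group B] {φ : B →* MulAut G} {ι : Type*} [Finite ι]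
  (hφ : NormalizedByInn φ)

theorem exists_lt_forall_mem_centerSeries {l : Ordinal.{w}} (hl : Order.IsSuccLimit l) {y : ι → G}
    (hy : ∀ i, y i ∈ (centerSeries φ hφ l).toSubgroup) :
    ∃ β < l, ∀ i, y i ∈ (centerSeries φ hφ β).toSubgroup := by
  choose β hβl hβ using fun i => (mem_centerSeries_limit hφ hl (y i)).1 (hy i)
  have : Nonempty (Set.Iio l) := ⟨⟨0, hl.bot_lt⟩⟩
  obtain ⟨M, hM⟩ := Finite.exists_le fun i => (⟨β i, hβl i⟩ : Set.Iio l)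
  exact ⟨M.1, M.2, fun i => centerSeries_mono hφ (hM i) (hβ i)⟩

theorem exists_isFixedPt_commMap {w : ι → List (ι × B)} {x : ι → G}
    (hx : ∀ i, (x i)⁻¹ * commMap φ w x i ∈ actionHypercenter φ hφ) :
    ∃ l, Function.IsFixedPt (commMap φ w) l ∧ ∀ i, (x i)⁻¹ * l i ∈ actionHypercenter φ hφ := by
  obtain ⟨α, hα⟩ := exists_centerSeries_eq_actionHypercenter hφ
  have hle (β : Ordinal.{u}) : (centerSeries φ hφ β).toSubgroup ≤ actionHypercenter φ hφ :=
    le_iSup (fun α : Ordinal.{u} => (centerSeries φ hφ α).toSubgroup) β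
  rw [← hα] at hx
  clear hα
  induction α using Ordinal.limitRecOn generalizing x with
  | zero =>
    refine ⟨x, funext fun i => ?_, fun i => by simp [one_mem]⟩
    have := hx i
    rw [centerSeries_zero, Subgroup.mem_bot, inv_mul_eq_one] at this
    exact this.symm
  | add_one β ih =>
    obtain ⟨l, hl, hxl⟩ := ih (x := commMap φ w x) fun i =>
      commWord_inv_mul_mem hφ (fun i => (mem_centerStep φ _ _).2
        ((mem_centerSeries_succ hφ β _).1 (hx i))) (w i)
    exact ⟨l, hl, fun i => by simpa [mul_assoc] using mul_mem (hle _ (hx i)) (hxl i)⟩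
  | limit γ hγ ih =>
    obtain ⟨β, hβ, h⟩ := exists_lt_forall_mem_centerSeries hφ hγ hx
    exact ih β hβ h

theorem eq_of_isFixedPt_commMap {w : ι → List (ι × B)} {l l' : ι → G}
    (hl : Function.IsFixedPt (commMap φ w) l) (hl' : Function.IsFixedPt (commMap φ w) l')
    (h : ∀ i, (l i)⁻¹ * l' i ∈ actionHypercenter φ hφ) : l = l' := by
  obtain ⟨α, hα⟩ := exists_centerSeries_eq_actionHypercenter hφ
  rw [← hα] at h
  clear hα
  induction α using Ordinal.limitRecOn with
  | zero =>
    funext i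
    have := h i
    rwa [centerSeries_zero, Subgroup.mem_bot, inv_mul_eq_one] at this
  | add_one β ih =>
    refine ih fun i => ?_
    rw [← congrFun hl i, ← congrFun hl' i]
    exact commWord_inv_mul_mem hφ (fun i => (mem_centerStep φ _ _).2
      ((mem_centerSeries_succ hφ β _).1 (h i))) (w i)
  | limit γ hγ ih =>
    obtain ⟨β, hβ, h⟩ := exists_lt_forall_mem_centerSeries hφ hγ h
    exact ih β hβ h

theorem apply_eq_of_isFixedPt_commMap {w : ι → List (ι × B)} {l : ι → G}
    (hl : Function.IsFixedPt (commMap φ w) l) {S : Subgroup (MulAut G)}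
    (hS : IsInvariant ((MulAut.conj : MulAut G →* _).comp φ) S)
    (hSφ : S ≤ Subgroup.normalizer (φ.range : Set (MulAut G)))
    (hSZ : ∀ σ ∈ S, ∀ g, g⁻¹ * σ g ∈ actionHypercenter φ hφ) {σ : MulAut G} (hσS : σ ∈ S)
    (hσ : HypercentralOver ((MulAut.conj : MulAut G →* _).comp φ) ⊥ σ) (i : ι) :
    σ (l i) = l i := by
  induction hσ generalizing i with
  | of_mem h => rw [Subgroup.mem_bot.1 h, MulAut.one_apply]
  | @of_commutator σ _ ih =>
    choose θ hθ using fun b => (hSφ (inv_mem hσS) (φ b)).1 ⟨b, rfl⟩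
    -- `φ (θ b) = σ⁻¹ * φ b * σ`, so `l` and `σ⁻¹ ∘ l` both solve the system with letters `θ b`.
    have hfix (b : B) (j : ι) : φ (θ b) (l j) = φ b (l j) := by
      calc φ (θ b) (l j) = φ (θ b) ((σ⁻¹ * MulAut.conj (φ b⁻¹) σ) (l j)) :=
            congrArg _ (ih b⁻¹ (hS.commutator_mem hσS b⁻¹) j).symm
        _ = φ b (l j) := by simp [hθ]
    suffices l = fun i => σ⁻¹ (l i) by
      rw [congrFun this i, MulAut.apply_inv_self, ← congrFun this i]
    refine eq_of_isFixedPt_commMap hφ (w := fun i => (w i).map (Prod.map id θ)) ?_ ?_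
      fun i => hSZ _ (inv_mem hσS) _
    · funext i
      exact (map_commWord (MonoidHom.id G) θ (fun i b => hfix b i) (w i)).symm.trans
        (congrFun hl i)
    · funext i
      refine (map_commWord (σ⁻¹ : MulAut G).toMonoidHom θ (fun i b => ?_) (w i)).symm.trans
        (congrArg (σ⁻¹ : MulAut G) (congrFun hl i))
      simp [hθ]

end FixedPoint

section Residual

variable {G : Type*} [Group G] {B : Type*} [Group B] {φ : B →* MulAut G}
  (hφ : NormalizedByInn φ)

/-- The commutator subgroup `[T, B]`, generated by the `y⁻¹ * φ b y` with `y ∈ T`. -/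
def actionCommutator (T : NormalInvariant φ) : NormalInvariant φ where
  toSubgroup := Subgroup.closure (Set.range fun p : T.toSubgroup × B => p.1.1⁻¹ * φ p.2 p.1)
  normal := ⟨fun n hn g => isInvariant_closure (φ := MulAut.conj) (by
    rintro g _ ⟨⟨y, b⟩, rfl⟩
    obtain ⟨c, hc⟩ := hφ.exists_conj g b
    refine Subgroup.subset_closure ⟨(⟨g * y * g⁻¹, T.normal.conj_mem y y.2 g⟩, c), ?_⟩
    simp [hc, mul_assoc]) g n hn⟩
  invariant := isInvariant_closure (by
    rintro c _ ⟨⟨y, b⟩, rfl⟩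
    refine Subgroup.subset_closure ⟨(⟨φ c y, T.invariant c y y.2⟩, c * b * c⁻¹), ?_⟩
    simp)

theorem actionCommutator_le (T : NormalInvariant φ) :
    (actionCommutator hφ T).toSubgroup ≤ T.toSubgroup := by
  refine (Subgroup.closure_le _).2 ?_
  rintro _ ⟨⟨y, b⟩, rfl⟩
  exact T.invariant.commutator_mem y.2 b

theorem exists_commWord_of_mem_actionCommutator {T : NormalInvariant φ} {g : G}
    (hg : g ∈ (actionCommutator hφ T).toSubgroup) :
    ∃ w : List (T.toSubgroup × B), commWord φ w Subtype.val = g := by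
  induction hg using Subgroup.closure_induction_left with
  | one => exact ⟨[], rfl⟩
  | mul_left _ hs g _ ih =>
    obtain ⟨p, rfl⟩ := hs
    obtain ⟨w, rfl⟩ := ih
    exact ⟨p :: w, rfl⟩
  | inv_mul_cancel _ hs g _ ih =>
    obtain ⟨⟨y, b⟩, rfl⟩ := hs
    obtain ⟨w, rfl⟩ := ih
    exact ⟨(⟨φ b y, T.invariant b y y.2⟩, b⁻¹) :: w, by simp [commWord]⟩

theorem exists_hypercentralOver_le_actionCommutator [Finite G] :
    ∃ T : NormalInvariant φ, (∀ g, HypercentralOver φ T.toSubgroup g) ∧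
      T.toSubgroup ≤ (actionCommutator hφ T).toSubgroup := by
  let P (S : Subgroup G) : Prop :=
    ∃ T : NormalInvariant φ, T.toSubgroup = S ∧ ∀ g, HypercentralOver φ T.toSubgroup g
  have htop : P ⊤ := ⟨⟨⊤, inferInstance, fun _ _ _ => Subgroup.mem_top _⟩, rfl,
    fun g => .of_mem (Subgroup.mem_top g)⟩
  obtain ⟨_, ⟨T, rfl, hT⟩, hmin⟩ := exists_minimal_of_wellFoundedLT P ⟨⊤, htop⟩
  refine ⟨T, hT, hmin ⟨actionCommutator hφ T, rfl, fun g => (hT g).trans fun x hx => ?_⟩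
    (actionCommutator_le hφ T)⟩
  exact .of_commutator fun b => .of_mem (Subgroup.subset_closure ⟨(⟨x, hx⟩, b), rfl⟩)

end Residual

section Transversal

variable {G : Type u} [Group G] {B : Type*} [Group B] {φ : B →* MulAut G}
  (hφ : NormalizedByInn φ)

theorem hypercentralOver_of_inv_mul_mem_actionHypercenter {N : NormalInvariant φ} {x y : G}
    (hx : x ∈ N.toSubgroup) (hxy : x⁻¹ * y ∈ actionHypercenter φ hφ) :
    HypercentralOver φ N.toSubgroup y := by
  have hmk : ((x⁻¹ * y : G) : G ⧸ N.toSubgroup) = y := by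
    simpa using (QuotientGroup.eq_one_iff x).2 hx
  rw [← hypercentralOver_quotientAction_iff N.toSubgroup N.invariant, ← hmk,
    hypercentralOver_quotientAction_iff]
  exact ((mem_actionHypercenter_iff hφ).1 hxy).mono bot_le

theorem exists_isFixedPt_commMap_hypercentralOver [(actionHypercenter φ hφ).FiniteIndex] :
    ∃ (ι : Type u) (_ : Finite ι) (w : ι → List (ι × B)) (l : ι → G),
      Nat.card ι ≤ (actionHypercenter φ hφ).index ∧ Function.IsFixedPt (commMap φ w) l ∧
      ∀ N : NormalInvariant φ, (∀ i, l i ∈ N.toSubgroup) →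
        ∀ g, HypercentralOver φ N.toSubgroup g := by
  let Z := hypercenterSubgroup hφ
  have : Z.toSubgroup.FiniteIndex := ‹(actionHypercenter φ hφ).FiniteIndex›
  obtain ⟨T, hT, hTle⟩ := exists_hypercentralOver_le_actionCommutator
    (hφ.quotientAction Z.toSubgroup Z.invariant)
  choose w hw using fun q : T.toSubgroup => exists_commWord_of_mem_actionCommutator _ (hTle q.2)
  let x (q : T.toSubgroup) : G := q.1.out
  have hx (q : T.toSubgroup) : (x q : G ⧸ Z.toSubgroup) = q := QuotientGroup.out_eq' q.1
  have hxw (q : T.toSubgroup) : (x q)⁻¹ * commMap φ w x q ∈ Z.toSubgroup := by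
    refine QuotientGroup.eq.1 ((hx q).trans ?_)
    rw [commMap, mk_commWord Z.invariant, funext hx]
    exact (hw q).symm
  obtain ⟨l, hl, hxl⟩ := exists_isFixedPt_commMap hφ hxw
  refine ⟨T.toSubgroup, inferInstance, w, l, Subgroup.card_le_card_group T.toSubgroup, hl,
    fun N hN g => ?_⟩
  have hg : HypercentralOver φ (T.toSubgroup.comap (QuotientGroup.mk' Z.toSubgroup)) g :=
    .of_map (QuotientGroup.mk' Z.toSubgroup) (fun b _ => ⟨b, rfl⟩) le_rfl (hT g)
  refine hg.trans fun y hy => hypercentralOver_of_inv_mul_mem_actionHypercenter hφ (hN ⟨y, hy⟩) ?_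
  exact QuotientGroup.eq.1
    ((QuotientGroup.eq (s := Z.toSubgroup).2 (hxl ⟨y, hy⟩)).symm.trans (hx ⟨y, hy⟩))

end Transversal

section InvariantClosure

variable {G : Type*} [Group G] {B : Type*} [Group B] {φ : B →* MulAut G} {s : Set G}

/-- The union of the orbits of the elements of `s`. -/
def orbitSet (φ : B →* MulAut G) (s : Set G) : Set G :=
  Set.image2 (fun b x => φ b x) Set.univ s

theorem subset_orbitSet (φ : B →* MulAut G) (s : Set G) : s ⊆ orbitSet φ s := fun x hx =>
  ⟨1, trivial, x, hx, by simp⟩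

theorem apply_mem_orbitSet (b : B) {x : G} (hx : x ∈ orbitSet φ s) : φ b x ∈ orbitSet φ s := by
  obtain ⟨c, -, y, hy, rfl⟩ := hx
  exact ⟨b * c, trivial, y, hy, by simp⟩

theorem finite_and_ncard_orbitSet_le {E : Subgroup B} [E.FiniteIndex]
    (hE : ∀ e ∈ E, ∀ x ∈ s, φ e x = x) (hs : s.Finite) :
    (orbitSet φ s).Finite ∧ (orbitSet φ s).ncard ≤ E.index * s.ncard := by
  have hsub : orbitSet φ s ⊆
      (fun p : (B ⧸ E) × G => φ p.1.out p.2) '' (Set.univ ×ˢ s) := by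
    rintro _ ⟨b, -, x, hx, rfl⟩
    exact ⟨((b : B ⧸ E), x), ⟨trivial, hx⟩, apply_out_eq (fun e he => hE e he x hx) b⟩
  have hfin : ((Set.univ : Set (B ⧸ E)) ×ˢ s).Finite := Set.finite_univ.prod hs
  refine ⟨(hfin.image _).subset hsub, (Set.ncard_le_ncard hsub (hfin.image _)).trans ?_⟩
  exact (Set.ncard_image_le hfin).trans_eq (by rw [Set.ncard_prod, Set.ncard_univ, Subgroup.index])

/-- The smallest normal invariant subgroup containing `s`. -/
def invariantClosure (φ : B →* MulAut G) (s : Set G) : NormalInvariant φ where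
  toSubgroup := Subgroup.closure (orbitSet MulAut.conj (orbitSet φ s))
  normal := ⟨fun x hx g => isInvariant_closure (φ := MulAut.conj)
    (fun g _ hx => Subgroup.subset_closure (apply_mem_orbitSet g hx)) g x hx⟩
  invariant := isInvariant_closure (by
    rintro b _ ⟨g, -, x, hx, rfl⟩
    exact Subgroup.subset_closure ⟨φ b g, trivial, φ b x, apply_mem_orbitSet b hx, by simp⟩)

theorem orbitSet_subset_invariantClosure (φ : B →* MulAut G) (s : Set G) :
    orbitSet φ s ⊆ (invariantClosure φ s).toSubgroup :=
  (subset_orbitSet _ _).trans Subgroup.subset_closure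

theorem subset_invariantClosure (φ : B →* MulAut G) (s : Set G) :
    s ⊆ (invariantClosure φ s).toSubgroup :=
  (subset_orbitSet φ s).trans (orbitSet_subset_invariantClosure φ s)

theorem invariantClosure_le {N : Subgroup G} [hN : N.Normal] (hNφ : IsInvariant φ N)
    (hs : s ⊆ N) : (invariantClosure φ s).toSubgroup ≤ N := by
  refine (Subgroup.closure_le N).2 ?_
  rintro _ ⟨g, -, _, ⟨b, -, x, hx, rfl⟩, rfl⟩
  exact hN.conj_mem _ (hNφ b x (hs hx)) g

end InvariantClosure

section Schur

open scoped commutatorElement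

variable {K : Type*} [Group K]

theorem commutatorElement_out_center (g h : K) :
    ⁅(g : K ⧸ Subgroup.center K).out, (h : K ⧸ Subgroup.center K).out⁆ = ⁅g, h⁆ := by
  obtain ⟨⟨y, hy⟩, hgy⟩ := QuotientGroup.mk_out_eq_mul (Subgroup.center K) g
  obtain ⟨⟨z, hz⟩, hhz⟩ := QuotientGroup.mk_out_eq_mul (Subgroup.center K) h
  rw [hgy, hhz, commutatorElement_def, commutatorElement_def]
  rw [Subgroup.mem_center_iff] at hy hz
  calc g * y * (h * z) * (g * y)⁻¹ * (h * z)⁻¹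
      = g * (y * h) * (z * (y⁻¹ * g⁻¹)) * z⁻¹ * h⁻¹ := by group
    _ = g * h * g⁻¹ * h⁻¹ := by rw [← hy h, ← hz (y⁻¹ * g⁻¹)]; group

theorem finite_and_card_commutatorSet_le [(Subgroup.center K).FiniteIndex] :
    Finite (commutatorSet K) ∧
      Nat.card (commutatorSet K) ≤ (Subgroup.center K).index * (Subgroup.center K).index := by
  have hrange : commutatorSet K = Set.range
      fun q : (K ⧸ Subgroup.center K) × (K ⧸ Subgroup.center K) => ⁅q.1.out, q.2.out⁆ := by
    ext x
    constructor
    · rintro ⟨g, h, rfl⟩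
      exact ⟨(g, h), commutatorElement_out_center g h⟩
    · rintro ⟨q, rfl⟩
      exact ⟨_, _, rfl⟩
  rw [hrange]
  exact ⟨inferInstance, (Finite.card_range_le _).trans_eq (Nat.card_prod _ _)⟩

theorem card_commutator_le_pow [hc : (Subgroup.center K).FiniteIndex] {t : ℕ}
    (ht : (Subgroup.center K).index ≤ t) :
    0 < Nat.card (commutator K) ∧ Nat.card (commutator K) ≤ t ^ (t * (t * t) + 1) := by
  obtain ⟨_, hcard⟩ := finite_and_card_commutatorSet_le (K := K)
  have hpos := Nat.pos_of_ne_zero hc.index_ne_zero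
  refine ⟨Nat.card_pos, (Nat.le_of_dvd (pow_pos hpos _)
    (Subgroup.card_commutator_dvd_index_center_pow K)).trans ?_⟩
  gcongr
  · exact hpos.trans_le ht
  · exact hcard.trans (Nat.mul_le_mul ht ht)

/-- A bound for the order of a group generated by `m` elements whose `t`-th powers lie in the
commutator subgroup, when the center has index at most `t`. -/
def orderBound (t m : ℕ) : ℕ := t ^ (t * (t * t) + 1) * t ^ m

theorem finite_and_card_le_orderBound {t : ℕ} [hc : (Subgroup.center K).FiniteIndex]
    (ht : (Subgroup.center K).index ≤ t) {s : Set K} (hs : s.Finite)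
    (hgen : Subgroup.closure s = ⊤) (hpow : ∀ x ∈ s, x ^ t ∈ commutator K) :
    Finite K ∧ Nat.card K ≤ orderBound t s.ncard := by
  have ht0 : 0 < t := (Nat.pos_of_ne_zero hc.index_ne_zero).trans_le ht
  have hgen' : Subgroup.closure ((Abelianization.of : K →* _) '' s) = ⊤ := by
    rw [← MonoidHom.map_closure, hgen]
    exact Subgroup.map_top_of_surjective _ (QuotientGroup.mk'_surjective _)
  obtain ⟨_, habel⟩ := card_le_pow_of_commute (K := Abelianization K) mul_comm (hs.image _) hgen'
    ht0 (by rintro _ ⟨x, hx, rfl⟩; exact (QuotientGroup.eq_one_iff _).2 (hpow x hx))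
  have hindex : (commutator K).index ≤ t ^ s.ncard :=
    habel.trans (Nat.pow_le_pow_right ht0 (Set.ncard_image_le hs))
  obtain ⟨hpos, hcomm⟩ := card_commutator_le_pow ht
  have hmul := Subgroup.card_mul_index (commutator K)
  refine ⟨Nat.finite_of_card_ne_zero ?_, hmul ▸ Nat.mul_le_mul hcomm hindex⟩
  rw [← hmul]
  exact mul_ne_zero hpos.ne' (Nat.card_pos (α := Abelianization K)).ne'

theorem finite_and_card_closure_le_orderBound {s : Set K} (hs : s.Finite) {Z : Subgroup K}
    [Z.FiniteIndex] (hZ : Subgroup.closure s ≤ Subgroup.centralizer (Z : Set K))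
    (hpow : ∀ x ∈ s, x ^ Z.index ∈ ⁅Subgroup.closure s, Subgroup.closure s⁆) :
    Finite (Subgroup.closure s) ∧
      Nat.card (Subgroup.closure s) ≤ orderBound Z.index s.ncard := by
  have hcenter : Z.subgroupOf (Subgroup.closure s) ≤ Subgroup.center (Subgroup.closure s) :=
    fun z hz => Subgroup.mem_center_iff.2 fun x =>
      Subtype.ext (Subgroup.mem_centralizer_iff.1 (hZ x.2) z.1 hz).symm
  have := Subgroup.finiteIndex_of_le hcenter
  have hindex : (Subgroup.center (Subgroup.closure s)).index ≤ Z.index :=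
    (Subgroup.index_antitone hcenter).trans <| Z.relIndex_top_right ▸
      Subgroup.relIndex_le_of_le_right le_top (Z.relIndex_top_right.trans_ne
        Subgroup.FiniteIndex.index_ne_zero)
  have hmem : s ⊆ Set.range (Subtype.val : Subgroup.closure s → K) := fun x hx =>
    ⟨⟨x, Subgroup.subset_closure hx⟩, rfl⟩
  rw [← Set.ncard_preimage_of_injective_subset_range Subtype.val_injective hmem]
  refine finite_and_card_le_orderBound hindex (hs.preimage Subtype.val_injective.injOn)
    Subgroup.closure_closure_coe_preimage fun x hx => ?_
  rw [← Subgroup.mem_map_iff_mem (Subgroup.subtype_injective _), Subgroup.map_subtype_commutator]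
  exact hpow x.1 hx

end Schur

section FixedPointStabilizer

variable {G : Type u} [Group G] {B : Type*} [Group B] {φ : B →* MulAut G}
  (hφ : NormalizedByInn φ)

theorem isInvariant_commutator {L : Subgroup G} (hL : IsInvariant φ L) : IsInvariant φ ⁅L, L⁆ :=
  fun b x hx => by
    have := Subgroup.mem_map_of_mem (φ b : G →* G) hx
    rwa [Subgroup.map_commutator, hL.map_eq] at this

/-- The elements of `B` that are hypercentral modulo the kernel of the action and act trivially on
the quotient by the hypercenter. -/
noncomputable def hypercentralKernel : Subgroup B :=
  hypercenterMod φ.ker ⊓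
    (quotientAction φ _ (hypercenterSubgroup hφ).invariant).ker

theorem finiteIndex_and_index_hypercentralKernel_le [(actionHypercenter φ hφ).FiniteIndex]
    [(hypercenterMod ((inn G).comap φ)).FiniteIndex] :
    (hypercentralKernel hφ).FiniteIndex ∧ (hypercentralKernel hφ).index ≤
      hypercenterIndexBound (actionHypercenter φ hφ).index
          (hypercenterMod ((inn G).comap φ)).index * (hypercenterMod ((inn G).comap φ)).index *
        (actionHypercenter φ hφ).index.factorial := by
  have : (hypercenterSubgroup hφ).toSubgroup.FiniteIndex :=
    ‹(actionHypercenter φ hφ).FiniteIndex›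
  obtain ⟨_, hle⟩ := finiteIndex_and_index_hypercenterMod_ker_le hφ
  have : (quotientAction φ _ (hypercenterSubgroup hφ).invariant).ker.FiniteIndex :=
    Subgroup.finiteIndex_ker _
  exact ⟨inferInstanceAs (_ ⊓ _ : Subgroup B).FiniteIndex,
    Subgroup.index_inf_le.trans (Nat.mul_le_mul hle (index_ker_le_factorial _))⟩

variable {ι : Type*} [Finite ι] {w : ι → List (ι × B)} {l : ι → G}
  (hl : Function.IsFixedPt (commMap φ w) l)
include hl

theorem conj_apply_eq_of_isFixedPt_commMap {z : G} (hz : z ∈ actionHypercenter φ hφ) (i : ι) :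
    MulAut.conj z (l i) = l i := by
  let Z := hypercenterSubgroup hφ
  refine apply_eq_of_isFixedPt_commMap hφ hl (S := Z.toSubgroup.map MulAut.conj) ?_ ?_ ?_
    (Subgroup.mem_map_of_mem _ hz) ?_ i
  · rintro b _ ⟨z, hz, rfl⟩
    exact ⟨φ b z, Z.invariant b z hz, by ext; simp⟩
  · exact (Subgroup.map_le_range _ _).trans hφ
  · rintro _ ⟨z, hz, rfl⟩ g
    have : g⁻¹ * z * g⁻¹⁻¹ * z⁻¹ ∈ actionHypercenter φ hφ :=
      mul_mem (Z.normal.conj_mem z hz g⁻¹) (inv_mem hz)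
    simpa [mul_assoc] using this
  · refine ((mem_actionHypercenter_iff hφ).1 hz).map MulAut.conj (fun b g => ⟨b, ?_⟩) bot_le
    ext
    simp

theorem apply_eq_of_mem_hypercentralKernel {e : B} (he : e ∈ hypercentralKernel hφ) (i : ι) :
    φ e (l i) = l i := by
  refine apply_eq_of_isFixedPt_commMap hφ hl (S := (hypercentralKernel hφ).map φ) ?_ ?_ ?_
    (Subgroup.mem_map_of_mem φ he) ?_ i
  · rintro b _ ⟨e, he, rfl⟩
    have : (hypercentralKernel hφ).Normal := inferInstanceAs (_ ⊓ _ : Subgroup B).Normal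
    exact ⟨b * e * b⁻¹, this.conj_mem e he b, by simp⟩
  · exact (Subgroup.map_le_range _ _).trans Subgroup.le_normalizer
  · rintro _ ⟨e, he, rfl⟩ g
    exact QuotientGroup.eq.1 (MulEquiv.congr_fun (MonoidHom.mem_ker.1 he.2) (g : G ⧸ _)).symm
  · exact (mem_hypercenterMod.1 he.1).map φ (fun b g => ⟨b, by simp⟩) φ.comap_bot.ge

theorem pow_index_mem_commutator_of_isFixedPt_commMap [(actionHypercenter φ hφ).FiniteIndex]
    {L : NormalInvariant φ} (hlL : ∀ i, l i ∈ L.toSubgroup) (i : ι) :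
    l i ^ (actionHypercenter φ hφ).index ∈ ⁅L.toSubgroup, L.toSubgroup⁆ := by
  let D := ⁅L.toSubgroup, L.toSubgroup⁆
  have hD : IsInvariant φ D := isInvariant_commutator L.invariant
  let n := (actionHypercenter φ hφ).index
  let M := L.toSubgroup.map (QuotientGroup.mk' D)
  have hM : IsInvariant (quotientAction φ D hD) M := by
    rintro b _ ⟨x, hx, rfl⟩
    exact ⟨φ b x, L.invariant b x hx, rfl⟩
  have hcomm : ∀ x ∈ M, ∀ y ∈ M, Commute x y := by
    rintro _ ⟨x, hx, rfl⟩ _ ⟨y, hy, rfl⟩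
    rw [← commutatorElement_eq_one_iff_commute, ← map_commutatorElement]
    exact (QuotientGroup.eq_one_iff _).2 (Subgroup.commutator_mem_commutator hx hy)
  have hfix : Function.IsFixedPt (commMap (quotientAction φ D hD) w)
      fun i => (l i : G ⧸ D) ^ n := funext fun i => by
    have hlM (j : ι) : (l j : G ⧸ D) ∈ M := ⟨l j, hlL j, rfl⟩
    rw [commMap, commWord_pow hM hcomm hlM, ← mk_commWord hD]
    exact congrArg (fun x : G => (x : G ⧸ D) ^ n) (congrFun hl i)
  refine (QuotientGroup.eq_one_iff _).1 (congrFun (eq_of_isFixedPt_commMap (hφ.quotientAction D hD)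
    (funext fun i => commWord_one (w i)) hfix fun i => ?_) i).symm
  have hpow : l i ^ n ∈ actionHypercenter φ hφ :=
    Subgroup.pow_index_mem (hypercenterSubgroup hφ).toSubgroup (l i)
  rw [inv_one, one_mul, mem_actionHypercenter_iff, ← QuotientGroup.mk_pow,
    hypercentralOver_quotientAction_iff]
  exact ((mem_actionHypercenter_iff hφ).1 hpow).mono bot_le

end FixedPointStabilizer

section FiniteResidual

variable {G : Type u} [Group G] {B : Type*} [Group B] {φ : B →* MulAut G}
  (hφ : NormalizedByInn φ)

/-- The bound of part (B) for a hypercenter of index `t`, when the hypercenter of `B` modulo the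
elements acting as inner automorphisms has index `k`. The second argument of `orderBound` counts
the generators: at most `t` fixed-point coordinates, and for each of them its orbit under `B` and
then under `Inn(G)`. -/
def residualBound (t k : ℕ) : ℕ :=
  orderBound t (t * (hypercenterIndexBound t k * k * t.factorial * t))

theorem exists_finite_hypercentralOver [(actionHypercenter φ hφ).FiniteIndex]
    [(hypercenterMod ((inn G).comap φ)).FiniteIndex] :
    ∃ L : NormalInvariant φ, Finite L.toSubgroup ∧
      Nat.card L.toSubgroup ≤ residualBound (actionHypercenter φ hφ).index
        (hypercenterMod ((inn G).comap φ)).index ∧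
      ∀ g, HypercentralOver φ L.toSubgroup g := by
  let Z := actionHypercenter φ hφ
  have hZ : Z.Normal := (hypercenterSubgroup hφ).normal
  obtain ⟨ι, _, w, l, hι, hl, hover⟩ := exists_isFixedPt_commMap_hypercentralOver hφ
  let L := invariantClosure φ (Set.range l)
  have hlL (i : ι) : l i ∈ L.toSubgroup := subset_invariantClosure φ _ ⟨i, rfl⟩
  have hLZ : L.toSubgroup ≤ Subgroup.centralizer (Z : Set G) := by
    refine invariantClosure_le (hypercenterSubgroup hφ).invariant.centralizer ?_
    rintro _ ⟨i, rfl⟩ z hz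
    exact mul_inv_eq_iff_eq_mul.1 (conj_apply_eq_of_isFixedPt_commMap hφ hl hz i)
  obtain ⟨_, hindex⟩ := finiteIndex_and_index_hypercentralKernel_le hφ
  obtain ⟨hfinB, hcardB⟩ := finite_and_ncard_orbitSet_le (φ := φ) (s := Set.range l)
    (fun e he x ⟨i, hi⟩ => hi ▸ apply_eq_of_mem_hypercentralKernel hφ hl he i) (Set.finite_range l)
  obtain ⟨hfin, hcard⟩ := finite_and_ncard_orbitSet_le (φ := MulAut.conj) (E := Z)
    (fun z hz x hx => mul_inv_eq_iff_eq_mul.2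
      (Subgroup.mem_centralizer_iff.1 (hLZ (orbitSet_subset_invariantClosure φ _ hx)) z hz)) hfinB
  have hpow : ∀ x ∈ orbitSet MulAut.conj (orbitSet φ (Set.range l)),
      x ^ Z.index ∈ ⁅L.toSubgroup, L.toSubgroup⁆ := by
    rintro _ ⟨g, -, _, ⟨b, -, _, ⟨i, rfl⟩, rfl⟩, rfl⟩
    rw [← map_pow, ← map_pow]
    exact Subgroup.Normal.conj_mem inferInstance _ (isInvariant_commutator L.invariant b _
      (pow_index_mem_commutator_of_isFixedPt_commMap hφ hl hlL i)) g
  obtain ⟨hLfin, hLcard⟩ := finite_and_card_closure_le_orderBound hfin hLZ hpow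
  refine ⟨L, hLfin, hLcard.trans (Nat.mul_le_mul_left _ (Nat.pow_le_pow_right
    (Nat.pos_of_ne_zero Subgroup.FiniteIndex.index_ne_zero) ?_)), hover L hlL⟩
  refine hcard.trans (Nat.mul_le_mul_left _ (hcardB.trans (Nat.mul_le_mul hindex ?_)))
  exact (Nat.card_coe_set_eq _).symm.trans_le ((Finite.card_range_le l).trans hι)

end FiniteResidual

end ActionHypercenter

theorem theorem2_general :
    (∃ f : ℕ → ℕ → ℕ,
      ∀ (G : Type u) [Group G] (B : Type v) [Group B] (φ : B →* MulAut G)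
        (hφ : NormalizedByInn φ) (t k : ℕ),
        (hypercenter (B ⧸ (inn G).comap φ)).FiniteIndex →
        (hypercenter (B ⧸ (inn G).comap φ)).index = k →
        (actionHypercenter φ hφ).FiniteIndex →
        (actionHypercenter φ hφ).index = t →
        ∃ (L : Subgroup G) (_ : L.Normal) (hL : IsInvariant φ L),
          Finite L ∧ Nat.card L ≤ f t k ∧
          IsActionHypercentral (quotientAction φ L hL) (hφ.quotientAction L hL)) ∧
    (∃ f : ℕ → ℕ → ℕ,
      ∀ (G : Type u) [Group G] (B : Type v) [Group B] (φ : B →* MulAut G)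
        (hφ : NormalizedByInn φ) (d k : ℕ),
        (hypercenter (B ⧸ (inn G).comap φ)).FiniteIndex →
        (hypercenter (B ⧸ (inn G).comap φ)).index = k →
        ∀ (L : Subgroup G) [L.Normal] (hL : IsInvariant φ L),
          Finite L → Nat.card L = d →
          IsActionHypercentral (quotientAction φ L hL) (hφ.quotientAction L hL) →
          (actionHypercenter φ hφ).FiniteIndex ∧
          (actionHypercenter φ hφ).index ≤ f d k) := by
  refine ⟨⟨residualBound, fun G _ B _ φ hφ t k hkfin hk _ ht => ?_⟩,
    ⟨hypercenterIndexBound, fun G _ B _ φ hφ d k hkfin hk L _ hL _ hd hhyp => ?_⟩⟩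
  all_goals
    rw [← index_hypercenterMod] at hk
    have : (hypercenterMod ((inn G).comap φ)).FiniteIndex :=
      ⟨(index_hypercenterMod _).trans_ne hkfin.index_ne_zero⟩
  · obtain ⟨L, hLfin, hcard, hover⟩ := exists_finite_hypercentralOver hφ
    rw [ht, hk] at hcard
    exact ⟨L.toSubgroup, L.normal, L.invariant, hLfin, hcard,
      (isActionHypercentral_quotientAction_iff hφ _ L.invariant).2 hover⟩
  · have hdvd : (actionHypercenter φ hφ).relIndex L ∣ Nat.card L := Subgroup.index_dvd_card _
    exact finiteIndex_and_index_le_of_relIndex hφ (Z := hypercenterSubgroup hφ)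
      (N := ⟨L, inferInstance, hL⟩) (centerStep_hypercenterSubgroup_le hφ)
      ((isActionHypercentral_quotientAction_iff hφ L hL).1 hhyp)
      (ne_zero_of_dvd_ne_zero Nat.card_pos.ne' hdvd)
      ((Nat.le_of_dvd Nat.card_pos hdvd).trans_eq hd) hk.le

theorem theorem2 :
    (∃ f : ℕ → ℕ → ℕ,
      ∀ (G : Type u) [Group G] (A : Subgroup (MulAut G)) (hA : NormalizedByInn A.subtype)
        (t k : ℕ),
        (hypercenter (A ⧸ (inn G).subgroupOf A)).FiniteIndex →
        (hypercenter (A ⧸ (inn G).subgroupOf A)).index = k →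
        (actionHypercenter A.subtype hA).FiniteIndex →
        (actionHypercenter A.subtype hA).index = t →
        ∃ (L : Subgroup G) (_ : L.Normal) (hL : IsInvariant A.subtype L),
          Finite L ∧ Nat.card L ≤ f t k ∧
          IsActionHypercentral (quotientAction A.subtype L hL) (hA.quotientAction L hL)) ∧
    (∃ f : ℕ → ℕ → ℕ,
      ∀ (G : Type u) [Group G] (A : Subgroup (MulAut G)) (hA : NormalizedByInn A.subtype)
        (d k : ℕ),
        (hypercenter (A ⧸ (inn G).subgroupOf A)).FiniteIndex →
        (hypercenter (A ⧸ (inn G).subgroupOf A)).index = k →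
        ∀ (L : Subgroup G) [L.Normal] (hL : IsInvariant A.subtype L),
          Finite L → Nat.card L = d →
          IsActionHypercentral (quotientAction A.subtype L hL) (hA.quotientAction L hL) →
          (actionHypercenter A.subtype hA).FiniteIndex ∧
          (actionHypercenter A.subtype hA).index ≤ f d k) := by
  obtain ⟨⟨f, hf⟩, ⟨h, hh⟩⟩ := theorem2_general.{u, u}
  exact ⟨⟨f, fun G _ A => hf G A A.subtype⟩, ⟨h, fun G _ A => hh G A A.subtype⟩⟩
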